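/- Let $n\ge 4$, let $t_1,\dots,t_n\in\mathbb C$ be distinct, let $D=t_1+\cdots+t_n$ on $\mathbb P^1_{\mathbb C}$, and let $\theta_i^\pm\in\mathbb C$ ($1\le i\le n$). For integers $d_1\le d_2$ use on $\mathcal O(d_1)\oplus\mathcal O(d_2)$ a basis $(e_1,e_2)$ of rational sections without zero or pole on $\mathbb C$, and write a connection as $Y\mapsto dY+\Omega Y$ with $\Omega$ a $2\times 2$ matrix of rational $1$-forms. Let $\nabla:E\to E\otimes\Omega^1(D)$ be a logarithmic connection on $E=\mathcal O\oplus\mathcal O(1)$ whose residue at $t_i$ has eigenvalues $\theta_i^+,\theta_i^-$ (with multiplicity) for every $i$. Let $L=\mathcal O(1)\subset E$. Assume that the set of zeroes on $\mathbb P^1$ of the composition $L\to E\xrightarrow{\nabla}E\otimes\Omega^1(D)\to(E/L)\otimes\Omega^1(D)$ consists of $n-3$ distinct points $q_1,\dots,q_{n-3}\in\mathbb C\setminus\{t_1,\dots,t_n\}$. Let $(E',\nabla')$ be obtained from $(E,\nabla)$ by the positive elementary transformations at all the $q_j$, directed by $L$; that is, sections of $E'$ near $q_j$ are the $s$ such that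 $(x-q_j)s$ is a section of $E$ with value at $q_j$ in $L|_{q_j}$, and $E'=E$ elsewhere. Let $\tilde l'_j\subset E'|_{q_j}$ be the new parabolic line, which is the image of $E|_{q_j}\to E'|_{q_j}$. Put $\tau_i=\prod_{k\ne i}(t_i-t_k)$ and, for $p\in\mathbb C^{n-3}$ and a polynomial $c(x)$, $$\Omega_{p,c}=\sum_{i=1}^n\begin{pmatrix}0&\frac1{\tau_i}\\-\tau_i\theta_i^+\theta_i^-&\theta_i^++\theta_i^-\end{pmatrix}\frac{dx}{x-t_i}+\sum_{j=1}^{n-3}\begin{pmatrix}0&0\\p_j&-1\end{pmatrix}\frac{dx}{x-q_j}+\begin{pmatrix}0&0\\c(x)&0\end{pmatrix}dx .$$ Then there are $p\in\mathbb C^{n-3}$ and a polynomial $c$ of degree at most $n-4$ such that: 1. There is an isomorphism from $\mathcal O\oplus\mathcal O(n-2)$ with the connection $d+\Omega_{p,c}$ onto $(E',\nabla')$, and it carries the kernel of the residue of $\Omega_{p,c}$ at $q_j$ onto $\tilde l'_j$ for every $j$. 2. The normal form is unique: if $(\mathcal O\oplus\mathcal O(n-2),\,d+\Omega_{p',c'})$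 is isomorphic to $(E',\nabla')$, then $p'=p$ and $c'=c$. 3. Among the polynomials $c'$ of degree at most $n-4$, $c'=c$ is the only one for which $d+\Omega_{p,c'}$ has scalar local monodromy around every $q_j$ (and for $c'=c$ it does). 4. The connection is determined by the $(q_j,p_j)$: if a second connection $\nabla_2$ on $E$ satisfies the same hypotheses with the same $t_i$, $\theta_i^\pm$, $q_j$, and its transform $(E',\nabla_2')$ has a normal form $\Omega_{p,c_2}$ with the same $p$, then some automorphism of $E$ conjugates $\nabla_2$ to $\nabla$, and it also induces an isomorphism $(E',\nabla'_2)\simeq(E',\nabla')$. -/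

import Mathlib

open Polynomial

noncomputable section

namespace Garnier

/-- The local ring of the projective line at a point, inside the function field `ℂ(x)`. -/
def localRing : OnePoint ℂ → Subring (RatFunc ℂ)
  | OnePoint.some a =>
    { carrier := {f | f.denom.eval a ≠ 0}
      mul_mem' := fun {f g} hf hg h => by
        obtain ⟨r, hr⟩ := RatFunc.denom_mul_dvd f g
        have h2 := congrArg (Polynomial.eval a) hr
        rw [Polynomial.eval_mul, Polynomial.eval_mul, h, zero_mul] at h2
        exact (mul_ne_zero hf hg) h2
      one_mem' := by simp
      add_mem' := fun {f g} hf hg h => by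
        obtain ⟨r, hr⟩ := RatFunc.denom_add_dvd f g
        have h2 := congrArg (Polynomial.eval a) hr
        rw [Polynomial.eval_mul, Polynomial.eval_mul, h, zero_mul] at h2
        exact (mul_ne_zero hf hg) h2
      zero_mem' := by simp
      neg_mem' := fun {f} hf h => by
        have h1 : (-f).denom ∣ f.denom := by
          have := RatFunc.denom_mul_dvd (-1 : RatFunc ℂ) f
          have h3 : (-1 : RatFunc ℂ).denom = 1 := by
            have := RatFunc.denom_algebraMap (-1 : ℂ[X])
            simpa using this
          rwa [h3, one_mul, neg_one_mul] at this
        have h2 : f.denom ∣ (-f).denom := by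
          have := RatFunc.denom_mul_dvd (-1 : RatFunc ℂ) (-f)
          have h3 : (-1 : RatFunc ℂ).denom = 1 := by
            have := RatFunc.denom_algebraMap (-1 : ℂ[X])
            simpa using this
          rwa [h3, one_mul, neg_one_mul, neg_neg] at this
        obtain ⟨r, hr⟩ := h2
        have h4 := congrArg (Polynomial.eval a) hr
        obtain ⟨r', hr'⟩ := h1
        have h5 := congrArg (Polynomial.eval a) hr'
        rw [Polynomial.eval_mul, h, zero_mul] at h5
        exact hf h5 }
  | OnePoint.infty =>
    { carrier := {f | f.intDegree ≤ 0}
      mul_mem' := fun {f g} hf hg => by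
        by_cases h1 : f = 0
        · simp [h1]
        by_cases h2 : g = 0
        · simp [h2]
        simp only [Set.mem_ofPred_eq] at *
        rw [RatFunc.intDegree_mul h1 h2]
        omega
      one_mem' := by simp
      add_mem' := fun {f g} hf hg => by
        by_cases h2 : g = 0
        · simpa [h2] using hf
        by_cases h3 : f + g = 0
        · simp [h3]
        simp only [Set.mem_ofPred_eq] at *
        exact (RatFunc.intDegree_add_le h2 h3).trans (max_le hf hg)
      zero_mem' := by simp
      neg_mem' := fun {f} hf => by
        simpa [RatFunc.intDegree_neg] using hf }

/-- A local coordinate: `x - a` at a finite point `a`, and `1 / x` at infinity. -/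
def coord : OnePoint ℂ → RatFunc ℂ
  | OnePoint.some a => RatFunc.X - RatFunc.C a
  | OnePoint.infty => (RatFunc.X)⁻¹

/-- A subsheaf of the constant sheaf `ℂ(x)²` on the projective line, given by its stalks (those
built below are stable under the action of the local rings). Every rank `2` vector bundle is of
this form once it is trivialised at the generic point, and every morphism of such bundles is
induced by a matrix over `ℂ(x)`. -/
abbrev Sheaf2 := OnePoint ℂ → AddSubgroup (Fin 2 → RatFunc ℂ)

/-- Local equation for `𝒪(k)`, whose germs at `p` are the rational functions `f` such that
`twistFactor k p * f` is regular at `p`. Sections are written in a basis without zero or pole on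
the affine line, so that the global sections of `𝒪(k)` are the polynomials of degree at most
`k`. -/
def twistFactor (k : ℤ) : OnePoint ℂ → RatFunc ℂ
  | OnePoint.some _ => 1
  | OnePoint.infty => (RatFunc.X) ^ (-k)

/-- The bundle `𝒪(d₁) ⊕ 𝒪(d₂)`. -/
def splitBundle (d₁ d₂ : ℤ) : Sheaf2 := fun p =>
  { carrier := {s | twistFactor d₁ p * s 0 ∈ localRing p ∧ twistFactor d₂ p * s 1 ∈ localRing p}
    add_mem' := fun {s u} hs hu => by
      refine ⟨?_, ?_⟩
      · rw [Pi.add_apply, mul_add]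
        exact add_mem hs.1 hu.1
      · rw [Pi.add_apply, mul_add]
        exact add_mem hs.2 hu.2
    zero_mem' := by simp
    neg_mem' := fun {s} hs => by
      refine ⟨?_, ?_⟩
      · rw [Pi.neg_apply, mul_neg]
        exact neg_mem hs.1
      · rw [Pi.neg_apply, mul_neg]
        exact neg_mem hs.2 }

/-- The generic fibre of the second summand; its intersection with `𝒪(d₁) ⊕ 𝒪(d₂)` is the
subbundle `𝒪(d₂)`. -/
def secondLine : Submodule (RatFunc ℂ) (Fin 2 → RatFunc ℂ) :=
  Submodule.span (RatFunc ℂ) {Pi.single 1 1}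

/-- Multiplication by the local coordinate at `p`. -/
def mulCoord (p : OnePoint ℂ) : (Fin 2 → RatFunc ℂ) →+ (Fin 2 → RatFunc ℂ) :=
  DistribSMul.toAddMonoidHom (Fin 2 → RatFunc ℂ) (coord p)

/-- The germs at `p` of sections of `E` whose value in the fibre of `E` at `p` belongs to the line
given by the subbundle `L = E ∩ ℓ`, that is, `L_p + 𝔪_p E_p`. -/
def directed (E : Sheaf2) (ℓ : Submodule (RatFunc ℂ) (Fin 2 → RatFunc ℂ)) : Sheaf2 := fun p =>
  (E p ⊓ ℓ.toAddSubgroup) ⊔ (E p).map (mulCoord p)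

open Classical in
/-- The negative elementary transformation of `E` at the points of `S`, directed by the subbundle
`E ∩ ℓ`. -/
def elmNeg (E : Sheaf2) (ℓ : Submodule (RatFunc ℂ) (Fin 2 → RatFunc ℂ)) (S : Set (OnePoint ℂ)) :
    Sheaf2 := fun p => if p ∈ S then directed E ℓ p else E p

open Classical in
/-- The twist of `E` by `𝒪(∑_{p ∈ S} p)`. -/
def twistAt (E : Sheaf2) (S : Set (OnePoint ℂ)) : Sheaf2 := fun p =>
  if p ∈ S then (E p).comap (mulCoord p) else E p

/-- The positive elementary transformation of `E` at the points of `S`, directed by the subbundle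
`E ∩ ℓ`: the negative one, twisted by `𝒪(∑_{p ∈ S} p)`. It agrees with `E` at the generic point, so
a connection on `E` and the one induced on the transform are the same operator on `ℂ(x)²`. -/
def elmPos (E : Sheaf2) (ℓ : Submodule (RatFunc ℂ) (Fin 2 → RatFunc ℂ)) (S : Set (OnePoint ℂ)) :
    Sheaf2 := twistAt (elmNeg E ℓ S) S

/-- The new parabolic structure on the positive elementary transformation `E'`, at a point `p` of
`S`: the germs of `E'` whose value at `p` lies on the new parabolic line. For the negative
transformation the new line is the kernel of the map of fibres induced by the inclusion in `E`;
this is then twisted. -/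
def elmPosLine (E : Sheaf2) (ℓ : Submodule (RatFunc ℂ) (Fin 2 → RatFunc ℂ))
    (S : Set (OnePoint ℂ)) : Sheaf2 := fun p =>
  (elmNeg E ℓ S p ⊓ (E p).map (mulCoord p)).comap (mulCoord p)

/-- The derivation `d/dx` of `ℂ(x)`. -/
def ratDeriv (f : RatFunc ℂ) : RatFunc ℂ :=
  algebraMap ℂ[X] (RatFunc ℂ) (derivative f.num * f.denom - f.num * derivative f.denom) /
    algebraMap ℂ[X] (RatFunc ℂ) (f.denom ^ 2)

/-- The operator `∇ = d + Ω dx` contracted with `d/dx`, at the generic point. -/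
def nabla (Ω : Matrix (Fin 2) (Fin 2) (RatFunc ℂ)) (s : Fin 2 → RatFunc ℂ) : Fin 2 → RatFunc ℂ :=
  fun i => ratDeriv (s i) + Ω.mulVec s i

open Classical in
/-- `logField D p • d/dx` generates, at `p`, the vector fields vanishing on `D` (up to sign), the
dual of `Ω¹(D)`. -/
def logField (D : Set ℂ) : OnePoint ℂ → RatFunc ℂ
  | OnePoint.some a => if a ∈ D then RatFunc.X - RatFunc.C a else 1
  | OnePoint.infty => RatFunc.X ^ 2

/-- `∇ = d + Ω dx` is a logarithmic connection `E → E ⊗ Ω¹(D)`. -/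
def IsLogConnection (E : Sheaf2) (D : Set ℂ) (Ω : Matrix (Fin 2) (Fin 2) (RatFunc ℂ)) : Prop :=
  ∀ p, ∀ s ∈ E p, logField D p • nabla Ω s ∈ E p

/-- The points where `∇` stabilises the subbundle `L = E ∩ ℓ`: the zeroes of the composition
`L → E → E ⊗ Ω¹(D) → (E / L) ⊗ Ω¹(D)`. -/
def apparentPoints (E : Sheaf2) (ℓ : Submodule (RatFunc ℂ) (Fin 2 → RatFunc ℂ)) (D : Set ℂ)
    (Ω : Matrix (Fin 2) (Fin 2) (RatFunc ℂ)) : Set (OnePoint ℂ) :=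
  {p | ∀ s ∈ E p, s ∈ ℓ → logField D p • nabla Ω s ∈ directed E ℓ p}

/-- The value at `a` of a rational function that is regular at `a`. -/
def value (a : ℂ) (f : RatFunc ℂ) : ℂ := RatFunc.eval (RingHom.id ℂ) a f

/-- The residue at `a` of a connection matrix with at most a simple pole at `a`. -/
def resMatrix (Ω : Matrix (Fin 2) (Fin 2) (RatFunc ℂ)) (a : ℂ) : Matrix (Fin 2) (Fin 2) ℂ :=
  ((RatFunc.X - RatFunc.C a) • Ω).map (value a)

/-- `M` is an isomorphism from `(E, d + Ω dx)` to `(E', d + Ω' dx)`. -/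
structure IsConnIso (M : GL (Fin 2) (RatFunc ℂ))
    (E : Sheaf2) (Ω : Matrix (Fin 2) (Fin 2) (RatFunc ℂ))
    (E' : Sheaf2) (Ω' : Matrix (Fin 2) (Fin 2) (RatFunc ℂ)) : Prop where
  bundle : ∀ p s, M.1.mulVec s ∈ E' p ↔ s ∈ E p
  conj : ∀ s, nabla Ω' (M.1.mulVec s) = M.1.mulVec (nabla Ω s)

/-- The local monodromy of `d + Ω dx` around `q` is scalar: for some `μ`, the flat sections have a
fundamental matrix `(x - q) ^ μ • Y(x)` near `q`, with `Y` single-valued on a punctured disc (so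
that the monodromy is multiplication by `exp (2 π i μ)`). -/
def HasScalarMonodromy (Ω : Matrix (Fin 2) (Fin 2) (RatFunc ℂ)) (q : ℂ) : Prop :=
  ∃ (μ : ℂ) (r : ℝ) (Y : ℂ → Matrix (Fin 2) (Fin 2) ℂ), 0 < r ∧
    ∀ x, x ≠ q → ‖x - q‖ < r → (Y x).det ≠ 0 ∧
      ∀ i j, HasDerivAt (fun z => Y z i j)
        ((-((Ω.map (value x) + (μ / (x - q)) • (1 : Matrix (Fin 2) (Fin 2) ℂ)) * Y x)) i j) x

/-- The logarithmic connection `d + Ω dx` on `𝒪 ⊕ 𝒪(1)` with poles `t i`, residual eigenvalues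
`θp i`, `θm i` over `t i`, and whose apparent points with respect to `𝒪(1)` are the `q j`. The points
`t i`, `q j` are meant to be two by two distinct. -/
structure IsGarnier {n : ℕ} (t θp θm : Fin n → ℂ) (q : Fin (n - 3) → ℂ)
    (Ω : Matrix (Fin 2) (Fin 2) (RatFunc ℂ)) : Prop where
  log : IsLogConnection (splitBundle 0 1) (Set.range t) Ω
  spectral : ∀ i, (resMatrix Ω (t i)).charpoly = (X - C (θp i)) * (X - C (θm i))
  apparent : apparentPoints (splitBundle 0 1) secondLine (Set.range t) Ω =
    Set.range (fun j => OnePoint.some (q j))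

/-- The bundle `E'` obtained from `E = 𝒪 ⊕ 𝒪(1)` by positive elementary transformations at the
points `q j`, directed by `𝒪(1)`. -/
def transform {m : ℕ} (q : Fin m → ℂ) : Sheaf2 :=
  elmPos (splitBundle 0 1) secondLine (Set.range (fun j => OnePoint.some (q j)))

/-- The new parabolic structure on `E'`. -/
def transformLine {m : ℕ} (q : Fin m → ℂ) : Sheaf2 :=
  elmPosLine (splitBundle 0 1) secondLine (Set.range (fun j => OnePoint.some (q j)))

/-- `τ i = ∏_{j ≠ i} (t i - t j)`. -/
def tau {n : ℕ} (t : Fin n → ℂ) (i : Fin n) : ℂ := ∏ j ∈ Finset.univ.erase i, (t i - t j)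

/-- The normal form. -/
def normalForm {n m : ℕ} (t θp θm : Fin n → ℂ) (q p : Fin m → ℂ) (c : ℂ[X]) :
    Matrix (Fin 2) (Fin 2) (RatFunc ℂ) :=
  (∑ i, (RatFunc.X - RatFunc.C (t i))⁻¹ •
      (!![0, 1 / tau t i; -(tau t i * θp i * θm i), θp i + θm i]).map (fun z : ℂ => RatFunc.C z)) +
    (∑ j, (RatFunc.X - RatFunc.C (q j))⁻¹ •
      (!![0, 0; p j, -1]).map (fun z : ℂ => RatFunc.C z)) +
    !![0, 0; algebraMap ℂ[X] (RatFunc ℂ) c, 0]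

end Garnier

end

namespace Garnier

-- Write P = ∏(x - t_i), Q = ∏(x - q_j), m = n - 3. Regularity away from the t_i and growth at
-- infinity force Ω = N / P with N polynomial. The upper right entry has degree at most m and
-- vanishes at the q_j, so N₀₁ = bQ with b ≠ 0 constant (`IsGarnier.exists_hasNumerators`). The
-- bundle E' is 𝒪 ⊕ 𝒪(m + 1) in the basis e₁, e₂ / Q (`mem_transform_iff`).
--
-- In the basis e₁ - (N₀₀ / bQ) e₂, e₂ / bQ of E' the upper row of the connection matrix becomes (0,
-- 1 / P) (`HasNumerators.gauge_eq`). The lower row follows by partial fractions: residues at the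
-- t_i come from the trace and determinant of those of Ω, residues at the q_j give p_j = N₀₀(q_j),
-- and the polynomial part left over is c. Its degree is at most m - 1 because the contributions of
-- order x^m cancel at infinity (`HasNumerators.natDegree_polyParam_le`).
--
-- Uniqueness: an automorphism of 𝒪 ⊕ 𝒪(m + 1) is lower triangular, and preserving the upper row (0,
-- 1 / P) forces it to be scalar (`normalForm_eq_of_isConnIso`).
--
-- Monodromy: the normal form is gauge equivalent to Ω, which is regular at q_j, so its local
-- monodromy is trivial. Replacing c by c + δ adds δ / bQ to the lower left entry of Ω, hence a
-- nilpotent residue at q_j proportional to δ(q_j). A Frobenius gauge reduces the equation to an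
-- Euler system, and a contour integral shows that scalar monodromy makes this residue zero
-- (`nilpotent_residue_eq_zero`). So δ vanishes at m points while having degree at most m - 1, and δ
-- = 0.
--
-- Consequently (q, p) determine c, hence the normal form. Two connections with the same (q, p) are
-- then conjugate by the quotient of their gauges, whose off-diagonal entry (N'₀₀ - N₀₀) / bQ is a
-- polynomial of degree at most 1 because the p_j agree: this is an automorphism of 𝒪 ⊕ 𝒪(1)
-- (`HasNumerators.isConnIso_of_residueParam_eq`).

local notation "ρ" => algebraMap ℂ[X] (RatFunc ℂ)

/-! ### The derivation of `ℂ(x)` -/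

lemma ofPoly_ne_zero {f : ℂ[X]} (hf : f ≠ 0) : ρ f ≠ 0 := RatFunc.algebraMap_ne_zero hf

lemma X_sub_C_eq (a : ℂ) : (RatFunc.X - RatFunc.C a : RatFunc ℂ) = ρ (X - C a) := by simp

lemma X_sub_C_ne_zero' (a : ℂ) : (RatFunc.X - RatFunc.C a : RatFunc ℂ) ≠ 0 := by
  rw [X_sub_C_eq]
  exact ofPoly_ne_zero (X_sub_C_ne_zero a)

lemma ratDeriv_def (f : RatFunc ℂ) :
    ratDeriv f = ρ (derivative f.num * f.denom - f.num * derivative f.denom) / ρ (f.denom ^ 2) := by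
  unfold ratDeriv
  exact rfl

/-- Frees the derivation from reduced fractions: the cross-multiplied identity is a combination of
num · b = a · denom and its derivative. The Leibniz rules then reduce to polynomial ones. -/
lemma ratDeriv_div (a : ℂ[X]) {b : ℂ[X]} (hb : b ≠ 0) :
    ratDeriv (ρ a / ρ b) = ρ (derivative a * b - a * derivative b) / ρ (b ^ 2) := by
  obtain ⟨f, hf⟩ : ∃ f : RatFunc ℂ, f = ρ a / ρ b := ⟨_, rfl⟩
  rw [← hf]
  have hd := f.denom_ne_zero
  have h : f.num * b = a * f.denom := (RatFunc.num_mul_eq_mul_denom_iff hb).2 hf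
  have h' := congrArg derivative h
  rw [derivative_mul, derivative_mul] at h'
  rw [ratDeriv_def, div_eq_div_iff (ofPoly_ne_zero (pow_ne_zero 2 hd))
    (ofPoly_ne_zero (pow_ne_zero 2 hb)), ← map_mul, ← map_mul]
  refine congrArg _ ?_
  linear_combination (f.denom * b) * h' - (derivative f.denom * b + derivative b * f.denom) * h

lemma ratDeriv_ofPoly (a : ℂ[X]) : ratDeriv (ρ a) = ρ (derivative a) := by
  simpa using ratDeriv_div a (one_ne_zero)

lemma exists_div_eq (f : RatFunc ℂ) : ∃ a b : ℂ[X], b ≠ 0 ∧ f = ρ a / ρ b :=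
  ⟨f.num, f.denom, f.denom_ne_zero, (RatFunc.num_div_denom f).symm⟩

lemma ratDeriv_mul (f g : RatFunc ℂ) :
    ratDeriv (f * g) = ratDeriv f * g + f * ratDeriv g := by
  obtain ⟨a, b, hb, rfl⟩ := exists_div_eq f
  obtain ⟨c, d, hd, rfl⟩ := exists_div_eq g
  have hb' := ofPoly_ne_zero hb
  have hd' := ofPoly_ne_zero hd
  rw [div_mul_div_comm, ← map_mul, ← map_mul, ratDeriv_div _ (mul_ne_zero hb hd),
    ratDeriv_div _ hb, ratDeriv_div _ hd]
  simp only [derivative_mul, map_mul, map_sub, map_add, map_pow]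
  field_simp
  ring

lemma ratDeriv_add (f g : RatFunc ℂ) : ratDeriv (f + g) = ratDeriv f + ratDeriv g := by
  obtain ⟨a, b, hb, rfl⟩ := exists_div_eq f
  obtain ⟨c, d, hd, rfl⟩ := exists_div_eq g
  have hb' := ofPoly_ne_zero hb
  have hd' := ofPoly_ne_zero hd
  rw [div_add_div _ _ hb' hd', ← map_mul, ← map_mul, ← map_mul, ← map_add,
    ratDeriv_div _ (mul_ne_zero hb hd), ratDeriv_div _ hb, ratDeriv_div _ hd]
  simp only [derivative_mul, map_mul, map_sub, map_add, map_pow]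
  field_simp
  ring

@[simp] lemma ratDeriv_zero : ratDeriv 0 = 0 := by simpa using ratDeriv_ofPoly 0

@[simp] lemma ratDeriv_one : ratDeriv 1 = 0 := by simpa using ratDeriv_ofPoly 1

@[simp] lemma ratDeriv_C (a : ℂ) : ratDeriv (RatFunc.C a) = 0 := by
  simpa using ratDeriv_ofPoly (C a)

@[simp] lemma ratDeriv_X : ratDeriv RatFunc.X = 1 := by simpa using ratDeriv_ofPoly X

lemma ratDeriv_inv {f : RatFunc ℂ} (hf : f ≠ 0) : ratDeriv f⁻¹ = -ratDeriv f / f ^ 2 := by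
  have h := ratDeriv_mul f f⁻¹
  rw [mul_inv_cancel₀ hf, ratDeriv_one] at h
  field_simp at h ⊢
  linear_combination -h

/-! ### Regular germs at finite points -/

lemma mem_localRing_coe {a : ℂ} {f : RatFunc ℂ} :
    f ∈ localRing (a : OnePoint ℂ) ↔ f.denom.eval a ≠ 0 := Iff.rfl

lemma div_mem_localRing {a : ℂ} (u : ℂ[X]) {v : ℂ[X]} (hv : v.eval a ≠ 0) :
    ρ u / ρ v ∈ localRing (a : OnePoint ℂ) := by
  rw [mem_localRing_coe]
  intro h
  obtain ⟨r, hr⟩ := RatFunc.denom_div_dvd u v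
  rw [hr, eval_mul, h, zero_mul] at hv
  exact hv rfl

lemma ofPoly_mem_localRing (a : ℂ) (u : ℂ[X]) : ρ u ∈ localRing (a : OnePoint ℂ) := by
  simpa using div_mem_localRing u (v := 1) (a := a) (by simp)

lemma C_mem_localRing (a b : ℂ) : RatFunc.C b ∈ localRing (a : OnePoint ℂ) := by
  simpa using ofPoly_mem_localRing a (C b)

lemma exists_div_of_mem {a : ℂ} {f : RatFunc ℂ} (hf : f ∈ localRing (a : OnePoint ℂ)) :
    ∃ u v : ℂ[X], v.eval a ≠ 0 ∧ f = ρ u / ρ v :=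
  ⟨f.num, f.denom, hf, (RatFunc.num_div_denom f).symm⟩

lemma value_eq (a : ℂ) (f : RatFunc ℂ) : value a f = f.num.eval a / f.denom.eval a := rfl

@[simp] lemma value_C (a b : ℂ) : value a (RatFunc.C b) = b := RatFunc.eval_C _ _
@[simp] lemma value_zero (a : ℂ) : value a 0 = 0 := RatFunc.eval_zero _ _
@[simp] lemma value_one (a : ℂ) : value a 1 = 1 := RatFunc.eval_one _ _

@[simp] lemma value_ofPoly (a : ℂ) (u : ℂ[X]) : value a (ρ u) = u.eval a := by
  simp [value_eq]

lemma value_mul {a : ℂ} {f g : RatFunc ℂ} (hf : f ∈ localRing (a : OnePoint ℂ))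
    (hg : g ∈ localRing (a : OnePoint ℂ)) : value a (f * g) = value a f * value a g :=
  RatFunc.eval_mul (RingHom.id ℂ) a hf hg

lemma value_add {a : ℂ} {f g : RatFunc ℂ} (hf : f ∈ localRing (a : OnePoint ℂ))
    (hg : g ∈ localRing (a : OnePoint ℂ)) : value a (f + g) = value a f + value a g :=
  RatFunc.eval_add (RingHom.id ℂ) a hf hg

lemma value_sum {κ : Type*} {a : ℂ} (s : Finset κ) (f : κ → RatFunc ℂ)
    (hf : ∀ i ∈ s, f i ∈ localRing (a : OnePoint ℂ)) :
    value a (∑ i ∈ s, f i) = ∑ i ∈ s, value a (f i) := by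
  classical
  induction s using Finset.induction_on with
  | empty => simp
  | insert b s hb ih =>
    rw [Finset.sum_insert hb, Finset.sum_insert hb, value_add (hf b (by simp))
      (sum_mem fun i hi => hf i (by simp [hi])), ih fun i hi => hf i (by simp [hi])]

lemma value_neg {a : ℂ} {f : RatFunc ℂ} (hf : f ∈ localRing (a : OnePoint ℂ)) :
    value a (-f) = -value a f := by
  have := value_add hf (neg_mem hf)
  rw [add_neg_cancel, value_zero] at this
  linear_combination -this

lemma value_sub {a : ℂ} {f g : RatFunc ℂ} (hf : f ∈ localRing (a : OnePoint ℂ))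
    (hg : g ∈ localRing (a : OnePoint ℂ)) : value a (f - g) = value a f - value a g := by
  rw [sub_eq_add_neg, value_add hf (neg_mem hg), value_neg hg, sub_eq_add_neg]

lemma value_div {a : ℂ} (u : ℂ[X]) {v : ℂ[X]} (hv : v.eval a ≠ 0) :
    value a (ρ u / ρ v) = u.eval a / v.eval a := by
  have hv0 : v ≠ 0 := by rintro rfl; simp at hv
  have h := value_mul (div_mem_localRing u hv) (ofPoly_mem_localRing a v)
  rw [div_mul_cancel₀ _ (ofPoly_ne_zero hv0), value_ofPoly, value_ofPoly] at h
  rw [eq_div_iff hv, ← h]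

lemma inv_mem_localRing {a : ℂ} {f : RatFunc ℂ} (hf : f ∈ localRing (a : OnePoint ℂ))
    (h : value a f ≠ 0) : f⁻¹ ∈ localRing (a : OnePoint ℂ) := by
  obtain ⟨u, v, hv, rfl⟩ := exists_div_of_mem hf
  rw [value_div u hv] at h
  rw [inv_div]
  exact div_mem_localRing v fun h0 => h (by rw [h0, zero_div])

lemma value_inv {a : ℂ} {f : RatFunc ℂ} (hf : f ∈ localRing (a : OnePoint ℂ))
    (h : value a f ≠ 0) : value a f⁻¹ = (value a f)⁻¹ := by
  have hf0 : f ≠ 0 := by rintro rfl; simp at h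
  have := value_mul hf (inv_mem_localRing hf h)
  rw [mul_inv_cancel₀ hf0, value_one] at this
  exact eq_inv_of_mul_eq_one_right this.symm

lemma ofPoly_inv_mem_localRing {a : ℂ} {u : ℂ[X]} (h : u.eval a ≠ 0) :
    (ρ u)⁻¹ ∈ localRing (a : OnePoint ℂ) :=
  inv_mem_localRing (ofPoly_mem_localRing a u) (by simpa)

lemma inv_X_sub_C_mem {a b : ℂ} (h : a ≠ b) :
    (RatFunc.X - RatFunc.C b)⁻¹ ∈ localRing (a : OnePoint ℂ) := by
  rw [X_sub_C_eq]
  exact ofPoly_inv_mem_localRing (by simpa [sub_eq_zero] using h)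

lemma X_sub_C_mem (a b : ℂ) : (RatFunc.X - RatFunc.C b) ∈ localRing (a : OnePoint ℂ) := by
  rw [X_sub_C_eq]
  exact ofPoly_mem_localRing _ _

lemma value_X_sub_C (a b : ℂ) : value a (RatFunc.X - RatFunc.C b) = a - b := by
  rw [X_sub_C_eq, value_ofPoly]; simp

lemma div_X_sub_C_mem_iff {a : ℂ} {f : RatFunc ℂ} (hf : f ∈ localRing (a : OnePoint ℂ)) :
    f / (RatFunc.X - RatFunc.C a) ∈ localRing (a : OnePoint ℂ) ↔ value a f = 0 := by
  constructor
  · intro h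
    have := value_mul (X_sub_C_mem a a) h
    rwa [mul_div_cancel₀ _ (X_sub_C_ne_zero' a), value_X_sub_C, sub_self, zero_mul] at this
  · intro h
    obtain ⟨u, v, hv, rfl⟩ := exists_div_of_mem hf
    rw [value_div u hv, div_eq_zero_iff, or_iff_left hv] at h
    obtain ⟨w, rfl⟩ := dvd_iff_isRoot.2 h
    have : ρ ((X - C a) * w) / ρ v / (RatFunc.X - RatFunc.C a) = ρ w / ρ v := by
      have := X_sub_C_ne_zero' a
      rw [map_mul, ← X_sub_C_eq]
      field_simp
    rw [this]
    exact div_mem_localRing w hv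

lemma exists_ofPoly_of_forall_mem {f : RatFunc ℂ} (hf : ∀ a : ℂ, f ∈ localRing (a : OnePoint ℂ)) :
    ∃ u : ℂ[X], f = ρ u := by
  have h : f.denom.degree = 0 := by
    by_contra h
    obtain ⟨a, ha⟩ := IsAlgClosed.exists_root f.denom h
    exact hf a ha
  have h1 : f.denom = 1 := eq_one_of_monic_natDegree_zero (RatFunc.monic_denom f)
    (natDegree_eq_zero_iff_degree_le_zero.2 h.le)
  refine ⟨f.num, ?_⟩
  conv_lhs => rw [← RatFunc.num_div_denom f, h1, map_one, div_one]

lemma analyticAt_value {a : ℂ} {f : RatFunc ℂ} (hf : f ∈ localRing (a : OnePoint ℂ)) :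
    AnalyticAt ℂ (fun z => value z f) a := by
  have h (u : ℂ[X]) : AnalyticAt ℂ (fun z => u.eval z) a :=
    u.differentiable.analyticAt a
  exact (h f.num).div (h f.denom) hf

lemma eventually_mem_localRing {a : ℂ} {f : RatFunc ℂ} (hf : f ∈ localRing (a : OnePoint ℂ)) :
    ∀ᶠ z : ℂ in nhds a, f ∈ localRing (z : OnePoint ℂ) :=
  (f.denom.continuous.continuousAt (x := a)).eventually_ne hf

lemma ratDeriv_mem_localRing {a : ℂ} {f : RatFunc ℂ} (hf : f ∈ localRing (a : OnePoint ℂ)) :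
    ratDeriv f ∈ localRing (a : OnePoint ℂ) :=
  ratDeriv_def f ▸ div_mem_localRing _ (by rw [eval_pow]; exact pow_ne_zero 2 hf)

lemma hasDerivAt_value {a : ℂ} {f : RatFunc ℂ} (hf : f ∈ localRing (a : OnePoint ℂ)) :
    HasDerivAt (fun z => value z f) (value a (ratDeriv f)) a := by
  have h := (f.num.hasDerivAt a).div (f.denom.hasDerivAt a) hf
  refine h.congr_deriv ?_
  rw [ratDeriv_def, value_div _ (by rw [eval_pow]; exact pow_ne_zero 2 hf)]
  simp

/-! ### Order at infinity -/

/-- The rational function has a pole of order at most `k` at infinity. -/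
def DegLE (k : ℤ) (f : RatFunc ℂ) : Prop := RatFunc.X ^ (-k) * f ∈ localRing OnePoint.infty

lemma mem_localRing_infty {f : RatFunc ℂ} : f ∈ localRing OnePoint.infty ↔ f.intDegree ≤ 0 :=
  Iff.rfl

lemma intDegree_X_zpow (k : ℤ) : (RatFunc.X ^ k : RatFunc ℂ).intDegree = k := by
  have h (n : ℕ) : (RatFunc.X ^ n : RatFunc ℂ).intDegree = n := by
    rw [← RatFunc.algebraMap_X, ← map_pow, RatFunc.intDegree_polynomial, natDegree_X_pow]
  cases k with
  | ofNat n => simpa using h n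
  | negSucc n => rw [zpow_negSucc, RatFunc.intDegree_inv, h]; rfl

lemma degLE_iff {k : ℤ} {f : RatFunc ℂ} (hf : f ≠ 0) : DegLE k f ↔ f.intDegree ≤ k := by
  rw [DegLE, mem_localRing_infty, RatFunc.intDegree_mul (zpow_ne_zero _ RatFunc.X_ne_zero) hf,
    intDegree_X_zpow]
  omega

lemma degLE_zero (k : ℤ) : DegLE k 0 := by
  rw [DegLE, mul_zero]; exact zero_mem _

lemma DegLE.add {k : ℤ} {f g : RatFunc ℂ} (hf : DegLE k f) (hg : DegLE k g) : DegLE k (f + g) := by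
  rw [DegLE, mul_add]; exact add_mem hf hg

lemma DegLE.neg {k : ℤ} {f : RatFunc ℂ} (hf : DegLE k f) : DegLE k (-f) := by
  rw [DegLE, mul_neg]; exact neg_mem hf

lemma DegLE.sub {k : ℤ} {f g : RatFunc ℂ} (hf : DegLE k f) (hg : DegLE k g) : DegLE k (f - g) := by
  rw [sub_eq_add_neg]; exact hf.add hg.neg

lemma DegLE.sum {κ : Type*} {k : ℤ} (s : Finset κ) {f : κ → RatFunc ℂ}
    (hf : ∀ i ∈ s, DegLE k (f i)) : DegLE k (∑ i ∈ s, f i) := by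
  rw [DegLE, Finset.mul_sum]; exact sum_mem hf

lemma DegLE.mul {k l : ℤ} {f g : RatFunc ℂ} (hf : DegLE k f) (hg : DegLE l g) :
    DegLE (k + l) (f * g) := by
  have h := mul_mem hf hg
  rwa [mul_mul_mul_comm, ← zpow_add₀ RatFunc.X_ne_zero, ← neg_add] at h

lemma DegLE.mono {k l : ℤ} {f : RatFunc ℂ} (hf : DegLE k f) (h : k ≤ l) : DegLE l f := by
  by_cases h0 : f = 0
  · rw [h0]; exact degLE_zero _
  · rw [degLE_iff h0] at *; omega

lemma DegLE.congr {k l : ℤ} {f : RatFunc ℂ} (hf : DegLE k f) (h : k = l) : DegLE l f := h ▸ hf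

lemma degLE_ofPoly_iff {k : ℕ} {u : ℂ[X]} : DegLE k (ρ u) ↔ u.natDegree ≤ k := by
  by_cases h : u = 0
  · simp [h, degLE_zero]
  · rw [degLE_iff (ofPoly_ne_zero h), RatFunc.intDegree_polynomial]; omega

lemma degLE_ofPoly (u : ℂ[X]) : DegLE u.natDegree (ρ u) := degLE_ofPoly_iff.2 le_rfl

lemma eq_zero_of_degLE {k : ℤ} (hk : k < 0) {u : ℂ[X]} (h : DegLE k (ρ u)) : u = 0 := by
  by_contra h0
  rw [degLE_iff (ofPoly_ne_zero h0), RatFunc.intDegree_polynomial] at h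
  omega

lemma degLE_C (a : ℂ) : DegLE 0 (RatFunc.C a) := by
  simpa using degLE_ofPoly (C a)

lemma degLE_X_zpow (k : ℤ) : DegLE k (RatFunc.X ^ k) :=
  (degLE_iff (zpow_ne_zero _ RatFunc.X_ne_zero)).2 (intDegree_X_zpow k).le

lemma degLE_inv_ofPoly {u : ℂ[X]} (hu : u ≠ 0) : DegLE (-u.natDegree) (ρ u)⁻¹ :=
  (degLE_iff (inv_ne_zero (ofPoly_ne_zero hu))).2
    (by rw [RatFunc.intDegree_inv, RatFunc.intDegree_polynomial])

lemma degLE_X_zpow_mul_iff {k l : ℤ} {f : RatFunc ℂ} :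
    DegLE k (RatFunc.X ^ l * f) ↔ DegLE (k - l) f := by
  rw [DegLE, DegLE, ← mul_assoc, ← zpow_add₀ RatFunc.X_ne_zero]
  congr! 3
  ring

lemma degLE_ofPoly_mul_iff {k : ℤ} {u : ℂ[X]} (hu : u ≠ 0) {f : RatFunc ℂ} :
    DegLE k (ρ u * f) ↔ DegLE (k - u.natDegree) f := by
  by_cases h0 : f = 0
  · simp [h0, degLE_zero]
  rw [degLE_iff (mul_ne_zero (ofPoly_ne_zero hu) h0), degLE_iff h0,
    RatFunc.intDegree_mul (ofPoly_ne_zero hu) h0, RatFunc.intDegree_polynomial]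
  omega

/-! ### Power series solutions of linear differential equations -/

section Frobenius

variable {𝔸 : Type*} [NormedRing 𝔸] [NormedAlgebra ℂ 𝔸]

/-- The coefficients of the power series solution of `z K' = K (z A + N) - N K`, `K(0) = 1`. -/
noncomputable def frobeniusCoeff (N : 𝔸) (A : ℕ → 𝔸) : ℕ → 𝔸
  | 0 => 1
  | k + 1 =>
    let S := ∑ i : Fin (k + 1), frobeniusCoeff N A i * A (k - i)
    ((k + 1 : ℂ)⁻¹) • S - ((k + 1 : ℂ)⁻¹ ^ 2) • (N * S - S * N) -
      ((k + 1 : ℂ)⁻¹ ^ 3) • ((2 : ℂ) • (N * S * N))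

/-- Each step inverts (k + 1) + ad N. Since N² = 0, ad N has cube zero and (ad N)² S = -2 N S N, so
the geometric series for the inverse stops after three terms. This is why no resonance occurs. -/
lemma frobeniusCoeff_rec {N : 𝔸} (hN : N * N = 0) (A : ℕ → 𝔸) (k : ℕ) :
    (k + 1 : ℂ) • frobeniusCoeff N A (k + 1) + N * frobeniusCoeff N A (k + 1) -
      frobeniusCoeff N A (k + 1) * N = ∑ i : Fin (k + 1), frobeniusCoeff N A i * A (k - i) := by
  rw [frobeniusCoeff]
  set S := ∑ i : Fin (k + 1), frobeniusCoeff N A i * A (k - i)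
  have hk : (k + 1 : ℂ) ≠ 0 := Nat.cast_add_one_ne_zero k
  set x := (k + 1 : ℂ)⁻¹ with hx
  have hkx : (k + 1 : ℂ) = x⁻¹ := by rw [hx, inv_inv]
  have hx0 : x ≠ 0 := inv_ne_zero hk
  have h1 : N * (N * S) = 0 := by rw [← mul_assoc, hN, zero_mul]
  have h2 : S * N * N = 0 := by rw [mul_assoc, hN, mul_zero]
  have h3 : N * (N * S * N) = 0 := by rw [← mul_assoc, h1, zero_mul]
  have h4 : N * S * N * N = 0 := by rw [mul_assoc, hN, mul_zero]
  have h5 : N * (S * N) = N * S * N := by rw [mul_assoc]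
  rw [hkx]
  simp only [mul_sub, sub_mul, smul_sub, mul_smul_comm, smul_mul_assoc, smul_smul, h1, h2, h3, h4,
    h5, smul_zero]
  have e1 : x⁻¹ * x = 1 := inv_mul_cancel₀ hx0
  have e2 : x⁻¹ * x ^ 2 = x := by field_simp
  have e3 : x⁻¹ * (x ^ 3 * 2) = 2 * x ^ 2 := by field_simp
  rw [e1, e2, e3]
  module

/-- The k + 1 terms of the convolution are compensated by the factor 1 / (k + 1) of the inverse
operator; its remaining factor is bounded by the constant 1 + 2‖N‖ + 2‖N‖², giving geometric growth.
-/
lemma norm_frobeniusCoeff_le (N : 𝔸) (A : ℕ → 𝔸) {M R : ℝ} (hM : 0 ≤ M) (hR : 0 ≤ R)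
    (hA : ∀ k, ‖A k‖ ≤ M * R ^ k) (k : ℕ) :
    ‖frobeniusCoeff N A k‖ ≤
      ‖(1 : 𝔸)‖ * (R + (1 + 2 * ‖N‖ + 2 * ‖N‖ ^ 2) * M) ^ k := by
  set c := 1 + 2 * ‖N‖ + 2 * ‖N‖ ^ 2 with hc
  have hc0 : 0 ≤ c := by positivity
  set r := R + c * M with hr
  have hr0 : 0 ≤ r := by positivity
  have hRr : R ≤ r := by rw [hr]; linarith [mul_nonneg hc0 hM]
  have hcr : c * M ≤ r := by rw [hr]; linarith
  induction k using Nat.strong_induction_on with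
  | _ k ih =>
    cases k with
    | zero => simp [frobeniusCoeff]
    | succ k =>
      rw [frobeniusCoeff]
      set S := ∑ i : Fin (k + 1), frobeniusCoeff N A i * A (k - i)
      have hS : ‖S‖ ≤ (k + 1) * (‖(1 : 𝔸)‖ * M * r ^ k) := by
        refine (norm_sum_le _ _).trans ?_
        have : ∀ i ∈ (Finset.univ : Finset (Fin (k + 1))),
            ‖frobeniusCoeff N A i * A (k - i)‖ ≤ ‖(1 : 𝔸)‖ * M * r ^ k := by
          intro i _
          have hi : (i : ℕ) ≤ k := Nat.lt_succ_iff.1 i.2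
          calc ‖frobeniusCoeff N A i * A (k - i)‖
              ≤ ‖frobeniusCoeff N A i‖ * ‖A (k - i)‖ := norm_mul_le _ _
            _ ≤ (‖(1 : 𝔸)‖ * r ^ (i : ℕ)) * (M * r ^ (k - i)) := by
                refine mul_le_mul (ih i i.2) ((hA _).trans ?_) (norm_nonneg _) (by positivity)
                gcongr
            _ = ‖(1 : 𝔸)‖ * M * (r ^ (i : ℕ) * r ^ (k - i)) := by ring
            _ = ‖(1 : 𝔸)‖ * M * r ^ k := by rw [← pow_add, Nat.add_sub_cancel' hi]
        refine (Finset.sum_le_card_nsmul _ _ _ this).trans ?_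
        simp
      have hk : (0 : ℝ) < k + 1 := by positivity
      have hx : ‖(k + 1 : ℂ)⁻¹‖ = (k + 1 : ℝ)⁻¹ := by
        rw [norm_inv]; congr 1; exact_mod_cast Complex.norm_natCast (k + 1)
      set x := (k + 1 : ℝ)⁻¹ with hxd
      have hx0 : 0 ≤ x := by positivity
      have hx1 : x ≤ 1 := inv_le_one_of_one_le₀ (by linarith [(Nat.cast_nonneg k : (0 : ℝ) ≤ k)])
      have hx2 : x ^ 2 ≤ x := by nlinarith
      have hx3 : x ^ 3 ≤ x := by nlinarith
      have hNS : ‖N * S‖ ≤ ‖N‖ * ‖S‖ := norm_mul_le _ _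
      have hSN : ‖S * N‖ ≤ ‖N‖ * ‖S‖ := (norm_mul_le _ _).trans_eq (mul_comm _ _)
      have hNSN : ‖N * S * N‖ ≤ ‖N‖ ^ 2 * ‖S‖ := by
        refine (norm_mul_le _ _).trans ?_
        nlinarith [norm_nonneg N]
      calc _ ≤ x * ‖S‖ + x ^ 2 * (‖N * S‖ + ‖S * N‖) + x ^ 3 * (2 * ‖N * S * N‖) := by
            refine (norm_sub_le _ _).trans (add_le_add ((norm_sub_le _ _).trans
              (add_le_add ?_ ?_)) ?_)
            · rw [norm_smul, hx]
            · rw [norm_smul, norm_pow, hx]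
              gcongr
              exact norm_sub_le _ _
            · rw [norm_smul, norm_smul, norm_pow, hx]
              simp
        _ ≤ x * ‖S‖ + x * (‖N‖ * ‖S‖ + ‖N‖ * ‖S‖) + x * (2 * (‖N‖ ^ 2 * ‖S‖)) := by
            gcongr
        _ = c * (x * ‖S‖) := by rw [hc]; ring
        _ ≤ c * (x * ((k + 1) * (‖(1 : 𝔸)‖ * M * r ^ k))) := by gcongr
        _ = ‖(1 : 𝔸)‖ * ((c * M) * r ^ k) := by rw [hxd]; field_simp
        _ ≤ ‖(1 : 𝔸)‖ * (r * r ^ k) := by gcongr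
        _ = ‖(1 : 𝔸)‖ * r ^ (k + 1) := by rw [pow_succ']

/-- The linear differential equation `z K' = K (z A + N) - N K` with `A` analytic at `0` and `N`
nilpotent of square zero has a solution with `K(0) = 1`. -/
theorem exists_frobenius_solution [CompleteSpace 𝔸] {N : 𝔸} (hN : N * N = 0) {A : ℂ → 𝔸}
    (hA : AnalyticAt ℂ A 0) :
    ∃ K K' : ℂ → 𝔸, K 0 = 1 ∧ ∀ᶠ z in nhds 0, HasDerivAt K (K' z) z ∧
      z • K' z = K z * (z • A z + N) - N * K z := by
  obtain ⟨p, s, hp⟩ := hA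
  obtain ⟨M, R, hM, hR, hpn⟩ : ∃ M R : ℝ, 0 < M ∧ 0 < R ∧ ∀ k, ‖p.coeff k‖ ≤ M * R ^ k := by
    obtain ⟨M, R, hM, hR, h⟩ := p.le_mul_pow_of_radius_pos (hp.r_pos.trans_le hp.r_le)
    exact ⟨M, R, hM, hR, fun k => by rw [← p.norm_apply_eq_norm_coef]; exact h k⟩
  set B := frobeniusCoeff N p.coeff with hB
  set r := R + (1 + 2 * ‖N‖ + 2 * ‖N‖ ^ 2) * M with hr
  have hr0 : 0 < r := by positivity
  have hRr : R ≤ r := by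
    have : 0 ≤ (1 + 2 * ‖N‖ + 2 * ‖N‖ ^ 2) * M := by positivity
    linarith
  have hBn : ∀ k, ‖B k‖ ≤ ‖(1 : 𝔸)‖ * r ^ k :=
    norm_frobeniusCoeff_le N p.coeff hM.le hR.le hpn
  -- On this disc the series is dominated by a geometric series of ratio 1/2, also after termwise
  -- differentiation.
  set δ := (2 * r)⁻¹ with hδ
  have hδ0 : 0 < δ := by positivity
  have hrδ : r * δ = 1 / 2 := by rw [hδ]; field_simp
  set T := Metric.ball (0 : ℂ) δ with hT
  have hu : Summable fun k : ℕ => ‖(1 : 𝔸)‖ * ((k : ℝ) * (r ^ k * δ ^ (k - 1))) := by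
    refine Summable.mul_left _ ?_
    have h := (summable_pow_mul_geometric_of_norm_lt_one 1 (r := (1 / 2 : ℝ)) (by norm_num)).mul_left
      δ⁻¹
    refine h.congr fun k => ?_
    cases k with
    | zero => simp
    | succ k =>
      rw [← hrδ, Nat.add_sub_cancel]
      field_simp
      ring_nf
  have hsumB : ∀ z ∈ T, Summable fun k => ‖z ^ k • B k‖ := by
    intro z hz
    have hz' : ‖z‖ < δ := by simpa [hT] using hz
    refine Summable.of_nonneg_of_le (fun _ => norm_nonneg _) (fun k => ?_)
      ((summable_geometric_two).mul_left ‖(1 : 𝔸)‖)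
    rw [norm_smul, norm_pow, ← hrδ, mul_pow]
    calc _ ≤ δ ^ k * (‖(1 : 𝔸)‖ * r ^ k) := by
          gcongr
          exact hBn k
      _ = _ := by ring
  have hsumA : ∀ z ∈ T, Summable fun k => ‖z ^ k • p.coeff k‖ := by
    intro z hz
    have hz' : ‖z‖ < δ := by simpa [hT] using hz
    refine Summable.of_nonneg_of_le (fun _ => norm_nonneg _) (fun k => ?_)
      ((summable_geometric_two).mul_left M)
    rw [norm_smul, norm_pow, ← hrδ, mul_pow]
    calc _ ≤ δ ^ k * (M * r ^ k) := by
          gcongr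
          exact (hpn k).trans (by gcongr)
      _ = _ := by ring
  have hder : ∀ z ∈ T, HasDerivAt (fun z => ∑' k, z ^ k • B k)
      (∑' k : ℕ, ((k : ℂ) * z ^ (k - 1)) • B k) z := by
    intro z hz
    refine hasDerivAt_tsum_of_isPreconnected hu Metric.isOpen_ball
      (convex_ball _ _).isPreconnected (g := fun k z => z ^ k • B k)
      (g' := fun k z => ((k : ℂ) * z ^ (k - 1)) • B k)
      (fun k y _ => (hasDerivAt_pow k y).smul_const (B k)) (fun k y hy => ?_)
      (Metric.mem_ball_self hδ0) (hsumB 0 (Metric.mem_ball_self hδ0)).of_norm hz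
    have hy' : ‖y‖ < δ := by simpa [hT] using hy
    rw [norm_smul, norm_mul, norm_pow, Complex.norm_natCast]
    calc _ ≤ ((k : ℝ) * δ ^ (k - 1)) * (‖(1 : 𝔸)‖ * r ^ k) := by
          gcongr
          exact hBn k
      _ = _ := by ring
  refine ⟨fun z => ∑' k, z ^ k • B k, fun z => ∑' k : ℕ, ((k : ℂ) * z ^ (k - 1)) • B k, ?_, ?_⟩
  · beta_reduce
    rw [tsum_eq_single 0 fun k hk => by simp [hk]]
    simp [hB, frobeniusCoeff]
  · have hev : ∀ᶠ z in nhds (0 : ℂ), z ∈ T := Metric.ball_mem_nhds _ hδ0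
    have hevA : ∀ᶠ z in nhds (0 : ℂ), z ∈ Metric.eball (0 : ℂ) s :=
      Metric.eball_mem_nhds _ hp.r_pos
    filter_upwards [hev, hevA] with z hz hzA
    refine ⟨hder z hz, ?_⟩
    have hAz : A z = ∑' k, z ^ k • p.coeff k := by
      have := (hp.hasSum hzA).tsum_eq
      simp only [zero_add, FormalMultilinearSeries.apply_eq_pow_smul_coeff] at this
      exact this.symm
    have hprod := tsum_mul_tsum_eq_tsum_sum_antidiagonal_of_summable_norm (hsumB z hz) (hsumA z hz)
    have hsB := (hsumB z hz).of_norm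
    have hd : Summable fun k : ℕ => ((k : ℂ) * z ^ (k - 1)) • B k := by
      refine Summable.of_norm_bounded hu fun k => ?_
      have hy' : ‖z‖ < δ := by simpa [hT] using hz
      rw [norm_smul, norm_mul, norm_pow, Complex.norm_natCast]
      calc _ ≤ ((k : ℝ) * δ ^ (k - 1)) * (‖(1 : 𝔸)‖ * r ^ k) := by
            gcongr
            exact hBn k
        _ = _ := by ring
    have hc := (summable_norm_sum_mul_antidiagonal_of_summable_norm (hsumB z hz)
      (hsumA z hz)).of_norm
    -- The term k = 0 on the right vanishes because B 0 = 1 commutes with N; after a shift by one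
    -- the rest is the recursion, summed by the Cauchy product.
    have key : z • ((∑' k, z ^ k • B k) * A z) = ∑' k : ℕ, (((k : ℂ) * z ^ k) • B k +
        (N * (z ^ k • B k) - (z ^ k • B k) * N)) := by
      rw [hAz, hprod, ← tsum_const_smul'']
      have hs : Summable fun k : ℕ => (((k : ℂ) * z ^ k) • B k +
        (N * (z ^ k • B k) - (z ^ k • B k) * N)) := by
        refine Summable.add ((hd.const_smul z).congr fun k => ?_)
          ((hsB.mul_left N).sub (hsB.mul_right N))
        cases k with
        | zero => simp
        | succ k => rw [smul_smul, Nat.add_sub_cancel, pow_succ]; congr 1; ring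
      rw [hs.tsum_eq_zero_add]
      have h0 : (((0 : ℕ) : ℂ) * z ^ 0) • B 0 + (N * (z ^ 0 • B 0) - (z ^ 0 • B 0) * N) = 0 := by
        simp [hB, frobeniusCoeff]
      rw [h0, zero_add]
      refine tsum_congr fun k => ?_
      have hrec := frobeniusCoeff_rec hN p.coeff k
      rw [← hB] at hrec
      have : (((k + 1 : ℕ) : ℂ) * z ^ (k + 1)) • B (k + 1) +
          (N * (z ^ (k + 1) • B (k + 1)) - (z ^ (k + 1) • B (k + 1)) * N) =
          z ^ (k + 1) • ((k + 1 : ℂ) • B (k + 1) + N * B (k + 1) - B (k + 1) * N) := by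
        rw [mul_smul_comm, smul_mul_assoc, smul_sub, smul_add, smul_smul, Nat.cast_add_one,
          mul_comm, add_sub_assoc]
      rw [this, hrec, Finset.Nat.sum_antidiagonal_eq_sum_range_succ_mk, Finset.sum_range,
        Finset.smul_sum, Finset.smul_sum]
      refine Finset.sum_congr rfl fun i _ => ?_
      have hi : (i : ℕ) ≤ k := Nat.lt_succ_iff.1 i.2
      rw [smul_mul_smul_comm, smul_smul, ← pow_add, Nat.add_sub_cancel' hi, pow_succ']
    have hd2 : z • (∑' k : ℕ, ((k : ℂ) * z ^ (k - 1)) • B k) = ∑' k : ℕ, ((k : ℂ) * z ^ k) • B k := by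
      rw [← tsum_const_smul'']
      refine tsum_congr fun k => ?_
      cases k with
      | zero => simp
      | succ k => rw [smul_smul, Nat.add_sub_cancel, pow_succ]; congr 1; ring
    have hd3 : Summable fun k : ℕ => ((k : ℂ) * z ^ k) • B k := by
      refine (hd.const_smul z).congr fun k => ?_
      cases k with
      | zero => simp
      | succ k => rw [smul_smul, Nat.add_sub_cancel, pow_succ]; congr 1; ring
    rw [hd3.tsum_add ((hsB.mul_left N).sub (hsB.mul_right N)),
      (hsB.mul_left N).tsum_sub (hsB.mul_right N), hsB.tsum_mul_left, hsB.tsum_mul_right] at key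
    rw [hd2, mul_add, mul_smul_comm, key]
    abel

end Frobenius

/-! ### Local fundamental matrices and monodromy -/

lemma hasDerivAt_matrix_mul {A B : ℂ → Matrix (Fin 2) (Fin 2) ℂ} {A' B' : Matrix (Fin 2) (Fin 2) ℂ}
    {x : ℂ} (hA : ∀ i j, HasDerivAt (fun z => A z i j) (A' i j) x)
    (hB : ∀ i j, HasDerivAt (fun z => B z i j) (B' i j) x) (i j : Fin 2) :
    HasDerivAt (fun z => (A z * B z) i j) ((A' * B x + A x * B') i j) x := by
  have h := ((hA i 0).mul (hB 0 j)).add ((hA i 1).mul (hB 1 j))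
  simp only [Matrix.mul_apply, Fin.sum_univ_two, Matrix.add_apply]
  refine h.congr_deriv ?_
  ring

section

attribute [local instance] Matrix.linftyOpNormedRing Matrix.linftyOpNormedAlgebra

theorem exists_frobenius_matrix {N : Matrix (Fin 2) (Fin 2) ℂ} (hN : N * N = 0) {q : ℂ}
    {A : ℂ → Matrix (Fin 2) (Fin 2) ℂ} (hA : ∀ i j, AnalyticAt ℂ (fun z => A z i j) q) :
    ∃ K K' : ℂ → Matrix (Fin 2) (Fin 2) ℂ, K q = 1 ∧ ∀ᶠ z in nhds q,
      (∀ i j, HasDerivAt (fun w => K w i j) (K' z i j) z) ∧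
      (z - q) • K' z = K z * ((z - q) • A z + N) - N * K z := by
  have : CompleteSpace (Matrix (Fin 2) (Fin 2) ℂ) := FiniteDimensional.complete ℂ _
  have hA' : AnalyticAt ℂ (fun z => A (z + q)) 0 := by
    have h : (fun z => A (z + q)) =
        fun z => ∑ i, ∑ j, A (z + q) i j • Matrix.single i j (1 : ℂ) := by
      funext z
      conv_lhs => rw [Matrix.matrix_eq_sum_single (A (z + q))]
      simp [Matrix.smul_single]
    rw [h]
    refine Finset.analyticAt_fun_sum _ fun i _ => Finset.analyticAt_fun_sum _ fun j _ => ?_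
    have h0 : AnalyticAt ℂ (fun z => A z i j) ((fun z : ℂ => z + q) 0) := by
      simpa using hA i j
    have h1 : AnalyticAt ℂ (fun z => A (z + q) i j) 0 :=
      h0.comp (f := fun z : ℂ => z + q) (analyticAt_id.add analyticAt_const)
    exact h1.smul (analyticAt_const (v := Matrix.single i j (1 : ℂ)))
  obtain ⟨K, K', h0, hK⟩ := exists_frobenius_solution hN hA'
  refine ⟨fun z => K (z - q), fun z => K' (z - q), by simpa using h0, ?_⟩
  have ht : Filter.Tendsto (fun z : ℂ => z - q) (nhds q) (nhds 0) := by
    have : ContinuousAt (fun z : ℂ => z - q) q := by fun_prop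
    simpa [ContinuousAt] using this
  filter_upwards [ht.eventually hK] with z hz
  refine ⟨fun i j => ?_, by simpa using hz.2⟩
  have h1 := hz.1.comp_sub_const z q
  exact (LinearMap.toContinuousLinearMap
    (Matrix.entryLinearMap ℂ ℂ i j)).hasFDerivAt.comp_hasDerivAt z h1

end

lemma eventually_det_ne_zero {K K' : ℂ → Matrix (Fin 2) (Fin 2) ℂ} {q : ℂ} (h1 : K q = 1)
    (hK : ∀ i j, HasDerivAt (fun w => K w i j) (K' q i j) q) :
    ∀ᶠ z in nhds q, (K z).det ≠ 0 := by
  have hc : ContinuousAt (fun z => (K z).det) q := by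
    simp only [Matrix.det_fin_two]
    exact ((hK 0 0).continuousAt.mul (hK 1 1).continuousAt).sub
      ((hK 0 1).continuousAt.mul (hK 1 0).continuousAt)
  exact hc.eventually_ne (by rw [h1]; simp)

/-- A linear differential equation has a fundamental matrix near a regular point. -/
theorem exists_fundamental_matrix {q : ℂ} {A : ℂ → Matrix (Fin 2) (Fin 2) ℂ}
    (hA : ∀ i j, AnalyticAt ℂ (fun z => A z i j) q) :
    ∃ Y : ℂ → Matrix (Fin 2) (Fin 2) ℂ, ∀ᶠ z in nhdsWithin q {q}ᶜ,
      (Y z).det ≠ 0 ∧ ∀ i j, HasDerivAt (fun w => Y w i j) ((-(A z * Y z)) i j) z := by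
  -- The Frobenius equation has its unknown on the left of A; transposing turns K' = -K Aᵀ into Y' =
  -- -A Y.
  obtain ⟨K, K', h0, hK⟩ := exists_frobenius_matrix (N := 0) (by simp)
    (A := fun z => -(A z).transpose) (fun i j => (hA j i).neg)
  refine ⟨fun z => (K z).transpose, ?_⟩
  filter_upwards [nhdsWithin_le_nhds hK,
    nhdsWithin_le_nhds (eventually_det_ne_zero h0 hK.self_of_nhds.1), self_mem_nhdsWithin]
    with z hz hd hne
  refine ⟨by rwa [Matrix.det_transpose], fun i j => (hz.1 j i).congr_deriv ?_⟩
  have hzq : z - q ≠ 0 := sub_ne_zero.2 hne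
  have h := hz.2
  rw [add_zero, zero_mul, sub_zero, mul_smul_comm] at h
  have h' : K' z = K z * -(A z).transpose := smul_right_injective _ hzq h
  rw [h', Matrix.mul_neg, Matrix.neg_apply, Matrix.neg_apply, ← Matrix.transpose_apply (K z * _),
    Matrix.transpose_mul, Matrix.transpose_transpose]

/-- The combinations u² / D and u w / D are free of the exponent μ, so no multivalued power is
needed. The first is a constant k, the second is a single-valued primitive of -ν k / (x - q), whose
integral around the circle is -2πi ν k. Hence k = 0. -/
lemma eq_zero_on_sphere {q μ ν : ℂ} {R : ℝ} (hR : 0 < R) (hν : ν ≠ 0) {u w D : ℂ → ℂ}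
    (hu : ∀ x ∈ Metric.sphere q R, HasDerivAt u (-(μ / (x - q)) * u x) x)
    (hw : ∀ x ∈ Metric.sphere q R,
      HasDerivAt w (-(μ / (x - q)) * w x - ν / (x - q) * u x) x)
    (hD : ∀ x ∈ Metric.sphere q R, HasDerivAt D (-(2 * μ / (x - q)) * D x) x)
    (hD0 : ∀ x ∈ Metric.sphere q R, D x ≠ 0) : ∀ x ∈ Metric.sphere q R, u x = 0 := by
  have hxq : ∀ x ∈ Metric.sphere q R, x - q ≠ 0 := by
    rintro x hx h
    rw [sub_eq_zero.1 h, Metric.mem_sphere, dist_self] at hx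
    exact hR.ne hx
  have hg : ∀ x ∈ Metric.sphere q R, HasDerivAt (fun z => u z * u z / D z) 0 x := by
    intro x hx
    have h1 := hxq x hx
    have h2 := hD0 x hx
    refine (((hu x hx).fun_mul (hu x hx)).fun_div (hD x hx) h2).congr_deriv ?_
    field_simp
    ring
  have hmem (θ : ℝ) : circleMap q R θ ∈ Metric.sphere q R := circleMap_mem_sphere q hR.le θ
  have hconst : ∀ θ θ' : ℝ, u (circleMap q R θ) * u (circleMap q R θ) / D (circleMap q R θ) =
      u (circleMap q R θ') * u (circleMap q R θ') / D (circleMap q R θ') := by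
    have hd (θ : ℝ) : HasDerivAt ((fun z => u z * u z / D z) ∘ circleMap q R) 0 θ := by
      simpa using (hg _ (hmem θ)).scomp θ (hasDerivAt_circleMap q R θ)
    exact is_const_of_deriv_eq_zero (fun θ => (hd θ).differentiableAt) fun θ => (hd θ).deriv
  set k := u (circleMap q R 0) * u (circleMap q R 0) / D (circleMap q R 0) with hk
  have hk' : ∀ x ∈ Metric.sphere q R, u x * u x / D x = k := by
    intro x hx
    have hx' : x ∈ Set.range (circleMap q R) := by rwa [range_circleMap, abs_of_pos hR]
    obtain ⟨θ, rfl⟩ := hx'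
    exact hconst θ 0
  have hint : (∮ z in C(q, R), -ν * k * (z - q)⁻¹) = 0 := by
    refine circleIntegral.integral_eq_zero_of_hasDerivWithinAt hR.le
      (f := fun z => u z * w z / D z) fun x hx => ?_
    have h1 := hxq x hx
    have h2 := hD0 x hx
    refine (((hu x hx).fun_mul (hw x hx)).fun_div (hD x hx) h2).hasDerivWithinAt.congr_deriv ?_
    rw [← hk' x hx]
    field_simp
    ring
  rw [circleIntegral.integral_const_mul, circleIntegral.integral_sub_center_inv q hR.ne'] at hint
  have hk0 : k = 0 := by
    have : (2 * Real.pi * Complex.I : ℂ) ≠ 0 := Complex.two_pi_I_ne_zero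
    simpa [hν] using hint
  intro x hx
  have := hk' x hx
  rw [hk0, div_eq_zero_iff, or_iff_left (hD0 x hx)] at this
  exact mul_self_eq_zero.1 this

/-- The local monodromy at a singularity with nilpotent residue is scalar only if the residue
vanishes. -/
theorem nilpotent_residue_eq_zero {q μ ν : ℂ} {A Z : ℂ → Matrix (Fin 2) (Fin 2) ℂ}
    (hA : ∀ i j, AnalyticAt ℂ (fun z => A z i j) q)
    (hZ : ∀ᶠ z in nhdsWithin q {q}ᶜ, (Z z).det ≠ 0 ∧ ∀ i j, HasDerivAt (fun w => Z w i j)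
      ((-((A z + (z - q)⁻¹ • !![0, 0; ν, 0] + (μ / (z - q)) • 1) * Z z)) i j) z) : ν = 0 := by
  by_contra hν
  set N : Matrix (Fin 2) (Fin 2) ℂ := !![0, 0; ν, 0] with hN
  have hNN : N * N = 0 := by
    rw [hN]; ext i j; fin_cases i <;> fin_cases j <;> simp [Matrix.mul_apply]
  -- The gauge K removes the regular part A: V = K Z satisfies the Euler system (z - q) V' = -(N +
  -- μ) V.
  obtain ⟨K, K', h0, hK⟩ := exists_frobenius_matrix hNN hA
  set V : ℂ → Matrix (Fin 2) (Fin 2) ℂ := fun z => K z * Z z with hV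
  have hVev : ∀ᶠ z in nhdsWithin q {q}ᶜ, (V z).det ≠ 0 ∧ ∀ i j, HasDerivAt (fun w => V w i j)
      ((-((z - q)⁻¹ • ((N + μ • 1) * V z))) i j) z := by
    filter_upwards [hZ, nhdsWithin_le_nhds hK,
      nhdsWithin_le_nhds (eventually_det_ne_zero h0 hK.self_of_nhds.1), self_mem_nhdsWithin]
      with z hz hk hd hne
    refine ⟨by rw [hV, Matrix.det_mul]; exact mul_ne_zero hd hz.1, fun i j => ?_⟩
    refine (hasDerivAt_matrix_mul hk.1
      (B' := (-((A z + (z - q)⁻¹ • N + (μ / (z - q)) • 1) * Z z))) hz.2 i j).congr_deriv ?_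
    have hzq : z - q ≠ 0 := sub_ne_zero.2 hne
    have hk' : K' z = (z - q)⁻¹ • (K z * ((z - q) • A z + N) - N * K z) := by
      rw [← hk.2, smul_smul, inv_mul_cancel₀ hzq, one_smul]
    refine congrFun (congrFun ?_ i) j
    rw [hk', hV]
    simp only [mul_add, add_mul, mul_neg, smul_sub, smul_add, mul_smul_comm, smul_mul_assoc,
      smul_smul, sub_mul, one_mul, inv_mul_cancel₀ hzq, one_smul, mul_assoc, div_eq_mul_inv,
      mul_comm μ]
    abel
  obtain ⟨r, hr, hball⟩ := Metric.mem_nhdsWithin_iff.1 hVev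
  have hmem : ∀ x ∈ Metric.sphere q (r / 2), x ∈ Metric.ball q r ∩ {q}ᶜ := by
    intro x hx
    rw [Metric.mem_sphere] at hx
    refine ⟨by rw [Metric.mem_ball, hx]; linarith, ?_⟩
    rintro rfl
    rw [dist_self] at hx
    linarith
  have hV' : ∀ x ∈ Metric.sphere q (r / 2), (V x).det ≠ 0 ∧ ∀ i j, HasDerivAt (fun w => V w i j)
      ((-((x - q)⁻¹ • ((N + μ • 1) * V x))) i j) x := fun x hx => hball (hmem x hx)
  have hrow0 (j : Fin 2) : ∀ x ∈ Metric.sphere q (r / 2),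
      HasDerivAt (fun z => V z 0 j) (-(μ / (x - q)) * V x 0 j) x := by
    intro x hx
    refine ((hV' x hx).2 0 j).congr_deriv ?_
    simp [hN, Matrix.mul_apply, Fin.sum_univ_two, div_eq_mul_inv]
    ring
  have hrow1 (j : Fin 2) : ∀ x ∈ Metric.sphere q (r / 2),
      HasDerivAt (fun z => V z 1 j) (-(μ / (x - q)) * V x 1 j - ν / (x - q) * V x 0 j) x := by
    intro x hx
    refine ((hV' x hx).2 1 j).congr_deriv ?_
    simp [hN, Matrix.mul_apply, Fin.sum_univ_two, div_eq_mul_inv]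
    ring
  have hdet : ∀ x ∈ Metric.sphere q (r / 2),
      HasDerivAt (fun z => (V z).det) (-(2 * μ / (x - q)) * (V x).det) x := by
    intro x hx
    simp only [Matrix.det_fin_two]
    refine (((hrow0 0 x hx).fun_mul (hrow1 1 x hx)).fun_sub
      ((hrow0 1 x hx).fun_mul (hrow1 0 x hx))).congr_deriv ?_
    ring
  -- Applied to each column of V with D = det V, this kills the whole first row, against det V ≠ 0.
  have hz (j : Fin 2) := eq_zero_on_sphere (half_pos hr) hν (hrow0 j) (hrow1 j) hdet
    fun x hx => (hV' x hx).1
  obtain ⟨x, hx⟩ : (Metric.sphere q (r / 2)).Nonempty := NormedSpace.sphere_nonempty.2 (half_pos hr).le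
  refine (hV' x hx).1 ?_
  rw [Matrix.det_fin_two, hz 0 x hx, hz 1 x hx]
  ring

/-! ### Partial fractions -/

/-- The monic polynomial with roots `z i`. -/
noncomputable abbrev nodal {n : ℕ} (z : Fin n → ℂ) : ℂ[X] := Lagrange.nodal Finset.univ z

section Nodal

variable {n : ℕ} (z : Fin n → ℂ)

lemma nodal_ne_zero : nodal z ≠ 0 := Lagrange.nodal_ne_zero

lemma ofPoly_nodal_ne_zero : ρ (nodal z) ≠ 0 := ofPoly_ne_zero (nodal_ne_zero z)

lemma natDegree_nodal : (nodal z).natDegree = n := by simp [nodal]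

lemma eval_nodal_ne_zero {a : ℂ} (h : ∀ i, a ≠ z i) : (nodal z).eval a ≠ 0 := by
  rw [nodal, Lagrange.eval_nodal]
  exact Finset.prod_ne_zero_iff.2 fun i _ => sub_ne_zero.2 (h i)

lemma eval_nodal_self (i : Fin n) : (nodal z).eval (z i) = 0 :=
  Lagrange.eval_nodal_at_node (Finset.mem_univ i)

lemma tau_eq_eval (i : Fin n) : tau z i = (Lagrange.nodal (Finset.univ.erase i) z).eval (z i) := by
  rw [Lagrange.eval_nodal, tau]

lemma tau_eq_derivative (i : Fin n) : tau z i = (derivative (nodal z)).eval (z i) := by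
  rw [tau_eq_eval, nodal, Lagrange.eval_nodal_derivative_eval_node_eq (Finset.mem_univ i)]

lemma nodal_eq_mul (i : Fin n) :
    nodal z = (X - C (z i)) * Lagrange.nodal (Finset.univ.erase i) z :=
  Lagrange.nodal_eq_mul_nodal_erase (Finset.mem_univ i)

variable {z}

lemma tau_ne_zero (hz : Function.Injective z) (i : Fin n) : tau z i ≠ 0 :=
  Finset.prod_ne_zero_iff.2 fun _ hj => sub_ne_zero.2 (hz.ne (Finset.ne_of_mem_erase hj).symm)

lemma X_sub_C_mul_div_nodal (G : ℂ[X]) (i : Fin n) :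
    (RatFunc.X - RatFunc.C (z i)) * (ρ G / ρ (nodal z)) =
      ρ G / ρ (Lagrange.nodal (Finset.univ.erase i) z) := by
  have h1 := X_sub_C_ne_zero' (z i)
  have h2 : ρ (Lagrange.nodal (Finset.univ.erase i) z) ≠ 0 :=
    ofPoly_ne_zero Lagrange.nodal_ne_zero
  rw [nodal_eq_mul z i, map_mul, ← X_sub_C_eq]
  field_simp

lemma eval_nodal_erase_ne_zero (hz : Function.Injective z) (i : Fin n) :
    (Lagrange.nodal (Finset.univ.erase i) z).eval (z i) ≠ 0 := by
  rw [← tau_eq_eval]; exact tau_ne_zero hz i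

lemma value_X_sub_C_mul_div_nodal (hz : Function.Injective z) (G : ℂ[X]) (i : Fin n) :
    value (z i) ((RatFunc.X - RatFunc.C (z i)) * (ρ G / ρ (nodal z))) =
      G.eval (z i) / tau z i := by
  rw [X_sub_C_mul_div_nodal, value_div _ (eval_nodal_erase_ne_zero hz i), tau_eq_eval]

/-- The remainder of G modulo the nodal polynomial is the Lagrange interpolant of G at the nodes;
dividing it by the nodal polynomial leaves simple poles with residues G(z i) / τ_i. The quotient is
the polynomial part. -/
lemma div_nodal_eq_sum (hz : Function.Injective z) (G : ℂ[X]) :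
    ρ G / ρ (nodal z) = ∑ i, (RatFunc.X - RatFunc.C (z i))⁻¹ *
      RatFunc.C (G.eval (z i) / tau z i) + ρ (G /ₘ nodal z) := by
  have hm : (nodal z).Monic := Lagrange.nodal_monic
  have h0 := ofPoly_nodal_ne_zero z
  have hG : G %ₘ nodal z = Lagrange.interpolate Finset.univ z (fun i => G.eval (z i)) := by
    refine Lagrange.eq_interpolate_of_eval_eq _ hz.injOn ?_ fun i _ => ?_
    · have := degree_modByMonic_lt G hm
      rwa [Lagrange.degree_nodal] at this
    · conv_rhs => rw [← modByMonic_add_div G (nodal z)]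
      simp [eval_nodal_self]
  conv_lhs => rw [← modByMonic_add_div G (nodal z), map_add, map_mul, add_div,
    mul_div_cancel_left₀ _ h0, hG, Lagrange.interpolate_apply, map_sum, Finset.sum_div]
  congr 1
  refine Finset.sum_congr rfl fun i _ => ?_
  rw [Lagrange.basis_eq_prod_sub_inv_mul_nodal_div (Finset.mem_univ i),
    ← Lagrange.nodal_erase_eq_nodal_div (Finset.mem_univ i),
    Lagrange.nodalWeight_eq_eval_derivative_nodal (Finset.mem_univ i), ← tau_eq_derivative,
    div_eq_iff h0, nodal_eq_mul z i]
  have h1 := X_sub_C_ne_zero' (z i)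
  simp only [map_mul, ← X_sub_C_eq, RatFunc.algebraMap_C, div_eq_mul_inv]
  field_simp

end Nodal

/-! ### Stalks of the split bundles -/

lemma mem_splitBundle_coe {d₁ d₂ : ℤ} {a : ℂ} {s : Fin 2 → RatFunc ℂ} :
    s ∈ splitBundle d₁ d₂ a ↔
      s 0 ∈ localRing (a : OnePoint ℂ) ∧ s 1 ∈ localRing (a : OnePoint ℂ) := by
  change 1 * s 0 ∈ _ ∧ 1 * s 1 ∈ _ ↔ _
  rw [one_mul, one_mul]

lemma mem_splitBundle_infty {d₁ d₂ : ℤ} {s : Fin 2 → RatFunc ℂ} :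
    s ∈ splitBundle d₁ d₂ OnePoint.infty ↔ DegLE d₁ (s 0) ∧ DegLE d₂ (s 1) := Iff.rfl

lemma nabla_single (Ω : Matrix (Fin 2) (Fin 2) (RatFunc ℂ)) (j i : Fin 2) :
    nabla Ω (Pi.single j 1) i = Ω i j := by
  rw [nabla, Matrix.mulVec_single_one]
  by_cases h : i = j
  · subst h; simp
  · simp [h]

lemma single_mem_splitBundle_coe {d₁ d₂ : ℤ} (a : ℂ) (j : Fin 2) :
    Pi.single j 1 ∈ splitBundle d₁ d₂ a := by
  rw [mem_splitBundle_coe]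
  fin_cases j <;> simp [zero_mem, one_mem]

lemma logField_coe_of_mem {D : Set ℂ} {a : ℂ} (h : a ∈ D) :
    logField D a = RatFunc.X - RatFunc.C a := if_pos h

lemma logField_coe_of_not_mem {D : Set ℂ} {a : ℂ} (h : a ∉ D) : logField D a = 1 := if_neg h

lemma mem_secondLine {s : Fin 2 → RatFunc ℂ} : s ∈ secondLine ↔ s 0 = 0 := by
  rw [secondLine, Submodule.mem_span_singleton]
  constructor
  · rintro ⟨a, rfl⟩; simp
  · intro h
    refine ⟨s 1, ?_⟩
    ext i
    fin_cases i <;> simp [h]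

lemma mem_directed_coe {d₁ d₂ : ℤ} {a : ℂ} {s : Fin 2 → RatFunc ℂ} :
    s ∈ directed (splitBundle d₁ d₂) secondLine a ↔
      s 0 / (RatFunc.X - RatFunc.C a) ∈ localRing (a : OnePoint ℂ) ∧
        s 1 ∈ localRing (a : OnePoint ℂ) := by
  have h0 := X_sub_C_ne_zero' a
  rw [directed, AddSubgroup.mem_sup]
  constructor
  · rintro ⟨u, ⟨hu, hu'⟩, w, ⟨v, hv, rfl⟩, rfl⟩
    have hu0 := mem_secondLine.1 hu'
    have hu1 := mem_splitBundle_coe.1 hu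
    have hv1 := mem_splitBundle_coe.1 hv
    have h1 (i : Fin 2) : (u + mulCoord a v) i = u i + (RatFunc.X - RatFunc.C a) * v i := rfl
    rw [h1, h1, hu0, zero_add, mul_div_cancel_left₀ _ h0]
    exact ⟨hv1.1, add_mem hu1.2 (mul_mem (X_sub_C_mem a a) hv1.2)⟩
  · rintro ⟨h1, h2⟩
    refine ⟨Pi.single 1 (s 1), ⟨mem_splitBundle_coe.2 ?_, mem_secondLine.2 (by simp)⟩, _,
      ⟨Pi.single 0 (s 0 / (RatFunc.X - RatFunc.C a)), mem_splitBundle_coe.2 ?_, rfl⟩, ?_⟩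
    · simp [h2, zero_mem]
    · simp [h1, zero_mem]
    · have h3 (v : Fin 2 → RatFunc ℂ) (i : Fin 2) :
        mulCoord a v i = (RatFunc.X - RatFunc.C a) * v i := rfl
      ext i
      rw [Pi.add_apply, h3]
      fin_cases i
      · simp [mul_div_cancel₀ _ h0]
      · simp

/-! ### The shape of the connection matrix -/

/-- A connection matrix with simple poles at the `t i` and numerators `N`, its behaviour at infinity
and at the poles being that of a logarithmic connection on `𝒪 ⊕ 𝒪(1)` with the given spectral data
and apparent points `q j`. -/
structure HasNumerators {n m : ℕ} (t θp θm : Fin n → ℂ) (q : Fin m → ℂ)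
    (Ω : Matrix (Fin 2) (Fin 2) (RatFunc ℂ)) (N : Matrix (Fin 2) (Fin 2) ℂ[X]) (b : ℂ) :
    Prop where
  entry : ∀ i j, Ω i j = ρ (N i j) / ρ (nodal t)
  ne_zero : b ≠ 0
  upper : N 0 1 = C b * nodal q
  degree₀₀ : (N 0 0).natDegree ≤ m + 1
  degree₁₀ : DegLE (-1) (Ω 1 0)
  degree₁₁ : DegLE (-2) (Ω 1 1 + RatFunc.X⁻¹)
  trace : ∀ i, (N 0 0 + N 1 1).eval (t i) = tau t i * (θp i + θm i)
  det : ∀ i, (N 0 0 * N 1 1 - N 0 1 * N 1 0).eval (t i) = tau t i ^ 2 * (θp i * θm i)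

/-- Multiplication by the nodal polynomial of the t_i makes every entry regular at all finite
points, and a rational function without finite poles is a polynomial. -/
lemma IsLogConnection.exists_numerators {n : ℕ} {t : Fin n → ℂ}
    {Ω : Matrix (Fin 2) (Fin 2) (RatFunc ℂ)}
    (h : IsLogConnection (splitBundle 0 1) (Set.range t) Ω) :
    ∃ N : Matrix (Fin 2) (Fin 2) ℂ[X], ∀ i j, Ω i j = ρ (N i j) / ρ (nodal t) := by
  have hmem (a : ℂ) (i j : Fin 2) :
      logField (Set.range t) a * Ω i j ∈ localRing (a : OnePoint ℂ) := by
    have h1 := mem_splitBundle_coe.1 (h a _ (single_mem_splitBundle_coe a j))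
    simp only [Pi.smul_apply, smul_eq_mul, nabla_single] at h1
    fin_cases i
    exacts [h1.1, h1.2]
  have hpol (i j : Fin 2) : ∃ u : ℂ[X], ρ (nodal t) * Ω i j = ρ u := by
    refine exists_ofPoly_of_forall_mem fun a => ?_
    by_cases ha : a ∈ Set.range t
    · have h1 := hmem a i j
      rw [logField_coe_of_mem ha] at h1
      obtain ⟨k, rfl⟩ := ha
      rw [nodal_eq_mul t k, mul_comm (X - C (t k)), map_mul, ← X_sub_C_eq, mul_assoc]
      exact mul_mem (ofPoly_mem_localRing _ _) h1
    · have h1 := hmem a i j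
      rw [logField_coe_of_not_mem ha, one_mul] at h1
      exact mul_mem (ofPoly_mem_localRing _ _) h1
  choose N hN using hpol
  refine ⟨Matrix.of N, fun i j => ?_⟩
  rw [eq_div_iff (ofPoly_nodal_ne_zero t), mul_comm, hN]
  rfl

/-- Testing the connection on local generators gives the pole orders, in particular deg N₀₁ ≤ n - 3.
This leaves no zeroes of N₀₁ beyond the n - 3 apparent points. -/
theorem IsGarnier.exists_hasNumerators {n : ℕ} (hn : 4 ≤ n) {t θp θm : Fin n → ℂ}
    {q : Fin (n - 3) → ℂ} (ht : Function.Injective t) (hq : Function.Injective q)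
    (hqt : ∀ j i, q j ≠ t i) {Ω : Matrix (Fin 2) (Fin 2) (RatFunc ℂ)}
    (h : IsGarnier t θp θm q Ω) : ∃ N b, HasNumerators t θp θm q Ω N b := by
  obtain ⟨N, hN⟩ := h.log.exists_numerators
  have hP := ofPoly_nodal_ne_zero t
  have hNΩ (i j : Fin 2) : ρ (N i j) = ρ (nodal t) * Ω i j := by
    rw [hN, mul_div_cancel₀ _ hP]
  -- behaviour at infinity
  have hinf0 := mem_splitBundle_infty.1 (h.log OnePoint.infty (Pi.single 0 1)
    (mem_splitBundle_infty.2 (by simpa using ⟨by simpa using degLE_C 1, degLE_zero 1⟩)))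
  have hX1 : DegLE 1 RatFunc.X := by simpa using degLE_X_zpow 1
  -- At infinity 𝒪(1) is generated by x e₂, while e₂ vanishes there.
  have hinf1 := mem_splitBundle_infty.1 (h.log OnePoint.infty (Pi.single 1 RatFunc.X)
    (mem_splitBundle_infty.2 (by simpa using ⟨degLE_zero 0, hX1⟩)))
  have hlog : logField (Set.range t) OnePoint.infty = RatFunc.X ^ (2 : ℤ) := by
    rw [zpow_ofNat]; rfl
  have hnab (i : Fin 2) : nabla Ω (Pi.single 1 RatFunc.X) i =
      (if i = 1 then 1 else 0) + RatFunc.X * Ω i 1 := by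
    rw [nabla]
    fin_cases i <;> simp [Matrix.mulVec, dotProduct, mul_comm]
  simp only [hlog, Pi.smul_apply, smul_eq_mul, nabla_single, degLE_X_zpow_mul_iff] at hinf0
  simp only [hlog, Pi.smul_apply, smul_eq_mul, hnab, degLE_X_zpow_mul_iff] at hinf1
  have hd00 : (N 0 0).natDegree ≤ n - 3 + 1 := by
    rw [← degLE_ofPoly_iff, hNΩ, degLE_ofPoly_mul_iff (nodal_ne_zero t), natDegree_nodal]
    exact hinf0.1.congr (by omega)
  have hd01 : (N 0 1).natDegree ≤ n - 3 := by
    have h1 := hinf1.1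
    rw [if_neg (by decide), zero_add, ← zpow_one RatFunc.X, degLE_X_zpow_mul_iff] at h1
    rw [← degLE_ofPoly_iff, hNΩ, degLE_ofPoly_mul_iff (nodal_ne_zero t), natDegree_nodal]
    exact h1.congr (by omega)
  -- Differentiating the generator x e₂ contributes the 1 here: Ω₁₁ is -1 / x up to order x⁻². The
  -- exact leading term is what makes the later degree bound on c work.
  have hd11 : DegLE (-2) (Ω 1 1 + RatFunc.X⁻¹) := by
    have h1 := hinf1.2
    have h2 : 1 + RatFunc.X * Ω 1 1 = RatFunc.X ^ (1 : ℤ) * (Ω 1 1 + RatFunc.X⁻¹) := by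
      rw [zpow_one, mul_add, mul_inv_cancel₀ RatFunc.X_ne_zero, add_comm]
    rw [if_pos trivial, h2, degLE_X_zpow_mul_iff] at h1
    exact h1.congr (by norm_num)
  -- the apparent points
  have happ (p : OnePoint ℂ) : p ∈ apparentPoints (splitBundle 0 1) secondLine (Set.range t) Ω ↔
      ∃ j, OnePoint.some (q j) = p := by
    rw [h.apparent]; rfl
  have hroot (j : Fin (n - 3)) : (N 0 1).eval (q j) = 0 := by
    have h1 := (happ (q j)).2 ⟨j, rfl⟩ _ (single_mem_splitBundle_coe (q j) 1)
      (mem_secondLine.2 (by simp))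
    have hnot : q j ∉ Set.range t := by
      rintro ⟨i, hi⟩
      exact hqt j i hi.symm
    rw [logField_coe_of_not_mem hnot, one_smul, mem_directed_coe, nabla_single, hN] at h1
    have h2 := eval_nodal_ne_zero t (hqt j)
    rw [div_X_sub_C_mem_iff (div_mem_localRing _ h2), value_div _ h2, div_eq_zero_iff,
      or_iff_left h2] at h1
    exact h1.1
  -- Otherwise 𝒪(1) would be stable and every point apparent, including a pole t_i.
  have hne : N 0 1 ≠ 0 := by
    intro h0
    have h1 : Ω 0 1 = 0 := by rw [hN, h0, map_zero, zero_div]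
    obtain ⟨j, hj⟩ := (happ (t ⟨0, by omega⟩)).1 (by
      intro s hs hs'
      have h2 := mem_splitBundle_coe.1 (h.log _ s hs)
      refine mem_directed_coe.2 ⟨?_, h2.2⟩
      have h3 : nabla Ω s 0 = 0 := by
        have := mem_secondLine.1 hs'
        simp [nabla, Matrix.mulVec, dotProduct, h1, this]
      simp [h3, zero_mem])
    exact hqt j _ (OnePoint.coe_injective hj)
  have hdvd : nodal q ∣ N 0 1 := by
    rw [nodal, Lagrange.nodal_eq]
    refine Finset.prod_dvd_of_coprime (fun i _ j _ hij => ?_) fun j _ => dvd_iff_isRoot.2 (hroot j)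
    exact isCoprime_X_sub_C_of_isUnit_sub (sub_ne_zero.2 (hq.ne hij)).isUnit
  obtain ⟨w, hw⟩ := hdvd
  have hw0 : w ≠ 0 := by rintro rfl; simp at hw; exact hne hw
  have hwd : w.natDegree = 0 := by
    have := congrArg natDegree hw
    rw [natDegree_mul (nodal_ne_zero q) hw0, natDegree_nodal] at this
    omega
  obtain ⟨b, rfl⟩ := natDegree_eq_zero.1 hwd
  -- the residues
  have hres (k : Fin n) (i j : Fin 2) :
      resMatrix Ω (t k) i j = (N i j).eval (t k) / tau t k := by
    rw [← value_X_sub_C_mul_div_nodal ht, ← hN]; rfl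
  have hchar (k : Fin n) : (resMatrix Ω (t k)).trace = θp k + θm k ∧
      (resMatrix Ω (t k)).det = θp k * θm k := by
    have h1 := h.spectral k
    rw [Matrix.charpoly_fin_two] at h1
    have h2 := congrArg (fun u => u.eval 0) h1
    have h3 := congrArg (fun u => u.eval 1) h1
    simp at h2 h3
    exact ⟨by linear_combination h2 - h3, h2⟩
  refine ⟨N, b, hN, fun h0 => hw0 (by rw [h0, C_0]), by rw [hw, mul_comm], hd00,
    hinf0.2.congr (by norm_num), hd11, fun k => ?_, fun k => ?_⟩
  · have h1 := (hchar k).1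
    have h0 := tau_ne_zero ht k
    rw [Matrix.trace_fin_two, hres, hres] at h1
    rw [← h1, eval_add]
    field_simp
  · have h1 := (hchar k).2
    have h0 := tau_ne_zero ht k
    rw [Matrix.det_fin_two, hres, hres, hres, hres] at h1
    rw [← h1]
    simp only [eval_sub, eval_mul]
    field_simp

/-! ### Gauge transformations -/

/-- The derivatives of s cancel in the difference of the two sides, so it is linear in s over ℂ(x)
and may be tested on basis vectors. -/
lemma gauge_iff {M Ω Ω' : Matrix (Fin 2) (Fin 2) (RatFunc ℂ)} :
    (∀ s, nabla Ω' (M.mulVec s) = M.mulVec (nabla Ω s)) ↔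
      M * Ω = Ω' * M + M.map ratDeriv := by
  have key (s : Fin 2 → RatFunc ℂ) (i : Fin 2) :
      nabla Ω' (M.mulVec s) i - M.mulVec (nabla Ω s) i =
        ((Ω' * M + M.map ratDeriv) - M * Ω).mulVec s i := by
    simp only [nabla, Matrix.mulVec, dotProduct, Fin.sum_univ_two, Matrix.sub_apply,
      Matrix.add_apply, Matrix.mul_apply, Matrix.map_apply, ratDeriv_add, ratDeriv_mul]
    ring
  constructor
  · intro h
    refine (sub_eq_zero.1 ?_).symm
    ext i j
    have := key (Pi.single j 1) i
    rw [h, sub_self, Matrix.mulVec_single_one] at this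
    exact this.symm
  · intro h s
    ext i
    rw [← sub_eq_zero, key s i, h, sub_self, Matrix.zero_mulVec, Pi.zero_apply]

lemma IsConnIso.symm {M : GL (Fin 2) (RatFunc ℂ)} {E E' : Sheaf2}
    {Ω Ω' : Matrix (Fin 2) (Fin 2) (RatFunc ℂ)} (h : IsConnIso M E Ω E' Ω') :
    IsConnIso M⁻¹ E' Ω' E Ω := by
  have h1 (s : Fin 2 → RatFunc ℂ) : M.1.mulVec (M⁻¹.1.mulVec s) = s := by
    rw [Matrix.mulVec_mulVec, ← Units.val_mul, mul_inv_cancel, Units.val_one, Matrix.one_mulVec]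
  have h2 (s : Fin 2 → RatFunc ℂ) : M⁻¹.1.mulVec (M.1.mulVec s) = s := by
    rw [Matrix.mulVec_mulVec, ← Units.val_mul, inv_mul_cancel, Units.val_one, Matrix.one_mulVec]
  refine ⟨fun p s => by rw [← h.bundle, h1], fun s => ?_⟩
  have := h.conj (M⁻¹.1.mulVec s)
  rw [h1] at this
  rw [this, h2]

lemma IsConnIso.trans {M M' : GL (Fin 2) (RatFunc ℂ)} {E E' E'' : Sheaf2}
    {Ω Ω' Ω'' : Matrix (Fin 2) (Fin 2) (RatFunc ℂ)} (h : IsConnIso M E Ω E' Ω')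
    (h' : IsConnIso M' E' Ω' E'' Ω'') : IsConnIso (M' * M) E Ω E'' Ω'' := by
  refine ⟨fun p s => ?_, fun s => ?_⟩
  · rw [Units.val_mul, ← Matrix.mulVec_mulVec, h'.bundle, h.bundle]
  · rw [Units.val_mul, ← Matrix.mulVec_mulVec, ← Matrix.mulVec_mulVec, h'.conj, h.conj]

/-! ### The transformed bundle -/

lemma mulCoord_apply (p : OnePoint ℂ) (s : Fin 2 → RatFunc ℂ) (i : Fin 2) :
    mulCoord p s i = coord p * s i := rfl

lemma coord_coe (a : ℂ) : coord (a : OnePoint ℂ) = RatFunc.X - RatFunc.C a := rfl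

section Transform

variable {m : ℕ} {q : Fin m → ℂ}

lemma inv_ofPoly_nodal_erase_mem (hq : Function.Injective q) (j : Fin m) :
    (ρ (Lagrange.nodal (Finset.univ.erase j) q))⁻¹ ∈ localRing (q j : OnePoint ℂ) :=
  ofPoly_inv_mem_localRing (eval_nodal_erase_ne_zero hq j)

lemma mul_mem_localRing_iff {a : ℂ} {f g : RatFunc ℂ} (hf : f ∈ localRing (a : OnePoint ℂ))
    (hf' : f⁻¹ ∈ localRing (a : OnePoint ℂ)) (h0 : f ≠ 0) :
    f * g ∈ localRing (a : OnePoint ℂ) ↔ g ∈ localRing (a : OnePoint ℂ) := by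
  refine ⟨fun h => ?_, fun h => mul_mem hf h⟩
  simpa [h0] using mul_mem hf' h

lemma nodal_mul_mem_iff (hq : Function.Injective q) (j : Fin m) (f : RatFunc ℂ) :
    ρ (nodal q) * f ∈ localRing (q j : OnePoint ℂ) ↔
      (RatFunc.X - RatFunc.C (q j)) * f ∈ localRing (q j : OnePoint ℂ) := by
  rw [nodal_eq_mul q j, mul_comm (X - C (q j)), map_mul, ← X_sub_C_eq, mul_assoc]
  exact mul_mem_localRing_iff (ofPoly_mem_localRing _ _) (inv_ofPoly_nodal_erase_mem hq j)
    (ofPoly_ne_zero Lagrange.nodal_ne_zero)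

lemma div_nodal_mem_iff (hq : Function.Injective q) (j : Fin m) {f : RatFunc ℂ}
    (hf : f ∈ localRing (q j : OnePoint ℂ)) :
    f / ρ (nodal q) ∈ localRing (q j : OnePoint ℂ) ↔ value (q j) f = 0 := by
  have h0 : ρ (Lagrange.nodal (Finset.univ.erase j) q) ≠ 0 :=
    ofPoly_ne_zero Lagrange.nodal_ne_zero
  rw [← div_X_sub_C_mem_iff hf, nodal_eq_mul q j, map_mul, ← X_sub_C_eq, ← div_div,
    div_eq_inv_mul _ (ρ _)]
  exact mul_mem_localRing_iff (inv_ofPoly_nodal_erase_mem hq j)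
    (by rw [inv_inv]; exact ofPoly_mem_localRing _ _) (inv_ne_zero h0)

lemma transform_coe_self (j : Fin m) : transform q (q j) =
    (directed (splitBundle 0 1) secondLine (q j)).comap (mulCoord (q j)) := by
  have h : (q j : OnePoint ℂ) ∈ Set.range fun j => (OnePoint.some (q j) : OnePoint ℂ) := ⟨j, rfl⟩
  rw [transform, elmPos, twistAt, if_pos h, elmNeg, if_pos h]

lemma transform_of_not_mem {p : OnePoint ℂ} (h : ∀ j, OnePoint.some (q j) ≠ p) :
    transform q p = splitBundle 0 1 p := by
  have h' : p ∉ Set.range fun j => (OnePoint.some (q j) : OnePoint ℂ) := by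
    rintro ⟨j, hj⟩
    exact h j hj
  rw [transform, elmPos, twistAt, if_neg h', elmNeg, if_neg h']

/-- The transformed bundle is `𝒪 ⊕ 𝒪(m + 1)` in the basis `e₁, e₂ / ∏ (x - q j)`. -/
lemma mem_transform_iff (hq : Function.Injective q) (p : OnePoint ℂ) (s : Fin 2 → RatFunc ℂ) :
    s ∈ transform q p ↔ ![s 0, ρ (nodal q) * s 1] ∈ splitBundle 0 (m + 1) p := by
  cases p using OnePoint.rec with
  | infty =>
    rw [transform_of_not_mem fun j => OnePoint.coe_ne_infty (q j), mem_splitBundle_infty,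
      mem_splitBundle_infty]
    simp only [Matrix.cons_val_zero, Matrix.cons_val_one]
    rw [degLE_ofPoly_mul_iff (nodal_ne_zero q), natDegree_nodal, add_sub_cancel_left]
  | coe a =>
    rw [mem_splitBundle_coe]
    simp only [Matrix.cons_val_zero, Matrix.cons_val_one]
    by_cases ha : ∃ j, q j = a
    · obtain ⟨j, rfl⟩ := ha
      rw [transform_coe_self, AddSubgroup.mem_comap, mem_directed_coe, mulCoord_apply,
        mulCoord_apply, coord_coe, mul_div_cancel_left₀ _ (X_sub_C_ne_zero' _),
        nodal_mul_mem_iff hq]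
    · push Not at ha
      rw [transform_of_not_mem fun j hj => ha j (OnePoint.coe_injective hj), mem_splitBundle_coe]
      have h := eval_nodal_ne_zero q fun j => (ha j).symm
      rw [mul_mem_localRing_iff (ofPoly_mem_localRing _ _) (ofPoly_inv_mem_localRing h)
        (ofPoly_nodal_ne_zero q)]

/-- The twist by the local coordinate cancels: what remains is the stalk of E itself, since (x -
q_j) E already lies in the directed subsheaf. Thus the new line is the image of the fibre of E. -/
lemma mem_transformLine_iff (j : Fin m) (s : Fin 2 → RatFunc ℂ) :
    s ∈ transformLine q (q j) ↔
      s 0 ∈ localRing (q j : OnePoint ℂ) ∧ s 1 ∈ localRing (q j : OnePoint ℂ) := by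
  have h : (q j : OnePoint ℂ) ∈ Set.range fun j => (OnePoint.some (q j) : OnePoint ℂ) := ⟨j, rfl⟩
  rw [transformLine, elmPosLine, elmNeg, if_pos h, AddSubgroup.mem_comap, AddSubgroup.mem_inf,
    mem_directed_coe, mulCoord_apply, mulCoord_apply, coord_coe,
    mul_div_cancel_left₀ _ (X_sub_C_ne_zero' _), ← mem_splitBundle_coe (d₁ := 0) (d₂ := 1)]
  constructor
  · rintro ⟨-, v, hv, hvs⟩
    have : v = s := by
      ext i
      have := congrFun hvs i
      rw [mulCoord_apply, mulCoord_apply] at this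
      exact mul_left_cancel₀ (X_sub_C_ne_zero' (q j)) this
    rwa [← this]
  · intro hs
    have hs' := mem_splitBundle_coe.1 hs
    exact ⟨⟨hs'.1, mul_mem (X_sub_C_mem _ _) hs'.2⟩, s, hs, rfl⟩

end Transform

/-! ### The normal form -/

section NormalForm

variable {n m : ℕ} {t θp θm : Fin n → ℂ} {q p : Fin m → ℂ} {c : ℂ[X]}

lemma normalForm_zero_zero : normalForm t θp θm q p c 0 0 = 0 := by
  simp [normalForm, Matrix.sum_apply]

lemma normalForm_zero_one' : normalForm t θp θm q p c 0 1 =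
    ∑ i, (RatFunc.X - RatFunc.C (t i))⁻¹ * RatFunc.C (1 / tau t i) := by
  simp [normalForm, Matrix.sum_apply]

lemma normalForm_one_zero : normalForm t θp θm q p c 1 0 =
    ∑ i, (RatFunc.X - RatFunc.C (t i))⁻¹ * RatFunc.C (-(tau t i * θp i * θm i)) +
      ∑ j, (RatFunc.X - RatFunc.C (q j))⁻¹ * RatFunc.C (p j) + ρ c := by
  simp [normalForm, Matrix.sum_apply]

lemma normalForm_one_one' : normalForm t θp θm q p c 1 1 =
    ∑ i, (RatFunc.X - RatFunc.C (t i))⁻¹ * RatFunc.C (θp i + θm i) +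
      ∑ j, (RatFunc.X - RatFunc.C (q j))⁻¹ * RatFunc.C (-1) := by
  simp [normalForm, Matrix.sum_apply]

lemma normalForm_zero_one (ht : Function.Injective t) (hn : 0 < n) :
    normalForm t θp θm q p c 0 1 = 1 / ρ (nodal t) := by
  have h := div_nodal_eq_sum ht 1
  rw [(divByMonic_eq_zero_iff Lagrange.nodal_monic).2 (by simpa using hn), map_zero, add_zero,
    map_one] at h
  rw [h, normalForm_zero_one']
  simp

lemma normalForm_add_single (c' : ℂ[X]) : normalForm t θp θm q p c' =
    normalForm t θp θm q p c + !![0, 0; ρ (c' - c), 0] := by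
  ext i j
  fin_cases i <;> fin_cases j <;> simp [normalForm, Matrix.sum_apply]

lemma sum_pole_mem {κ : ℕ} (z a : Fin κ → ℂ) {x : ℂ} (h : ∀ i, x ≠ z i) :
    ∑ i, (RatFunc.X - RatFunc.C (z i))⁻¹ * RatFunc.C (a i) ∈ localRing (x : OnePoint ℂ) :=
  sum_mem fun i _ => mul_mem (inv_X_sub_C_mem (h i)) (C_mem_localRing _ _)

lemma value_X_sub_C_mul_sum (hq : Function.Injective q) (a : Fin m → ℂ) (j : Fin m)
    {r : RatFunc ℂ} (hr : r ∈ localRing (q j : OnePoint ℂ)) :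
    value (q j) ((RatFunc.X - RatFunc.C (q j)) *
      (r + ∑ k, (RatFunc.X - RatFunc.C (q k))⁻¹ * RatFunc.C (a k))) = a j := by
  have h1 : (RatFunc.X - RatFunc.C (q j)) *
      (r + ∑ k, (RatFunc.X - RatFunc.C (q k))⁻¹ * RatFunc.C (a k)) =
      RatFunc.C (a j) + (RatFunc.X - RatFunc.C (q j)) * (r + ∑ k ∈ Finset.univ.erase j,
        (RatFunc.X - RatFunc.C (q k))⁻¹ * RatFunc.C (a k)) := by
    have h0 := X_sub_C_ne_zero' (q j)
    rw [← Finset.add_sum_erase _ _ (Finset.mem_univ j)]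
    field_simp
    ring
  have h2 : r + ∑ k ∈ Finset.univ.erase j, (RatFunc.X - RatFunc.C (q k))⁻¹ * RatFunc.C (a k) ∈
      localRing (q j : OnePoint ℂ) := by
    refine add_mem hr (sum_mem fun k hk => mul_mem (inv_X_sub_C_mem ?_) (C_mem_localRing _ _))
    exact hq.ne (Finset.ne_of_mem_erase hk).symm
  rw [h1, value_add (C_mem_localRing _ _) (mul_mem (X_sub_C_mem _ _) h2),
    value_mul (X_sub_C_mem _ _) h2, value_X_sub_C, value_C]
  ring

lemma value_residue_one_zero (hq : Function.Injective q) (hqt : ∀ j i, q j ≠ t i) (j : Fin m) :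
    value (q j) ((RatFunc.X - RatFunc.C (q j)) * normalForm t θp θm q p c 1 0) = p j := by
  rw [normalForm_one_zero, add_right_comm]
  exact value_X_sub_C_mul_sum hq p j
    (add_mem (sum_pole_mem _ _ (hqt j)) (ofPoly_mem_localRing _ _))

lemma resMatrix_normalForm (hq : Function.Injective q) (hqt : ∀ j i, q j ≠ t i) (j : Fin m) :
    resMatrix (normalForm t θp θm q p c) (q j) = !![0, 0; p j, -1] := by
  have h (i k : Fin 2) : resMatrix (normalForm t θp θm q p c) (q j) i k =
    value (q j) ((RatFunc.X - RatFunc.C (q j)) * normalForm t θp θm q p c i k) := rfl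
  ext i k
  rw [h]
  fin_cases i <;> fin_cases k
  · simp [normalForm_zero_zero]
  · have h1 := sum_pole_mem t (fun i => 1 / tau t i) (hqt j)
    simp only [Fin.zero_eta, Fin.mk_one]
    rw [normalForm_zero_one', value_mul (X_sub_C_mem _ _) h1, value_X_sub_C]
    simp
  · exact value_residue_one_zero hq hqt j
  · simp only [Fin.mk_one]
    rw [normalForm_one_one']
    exact value_X_sub_C_mul_sum hq (fun _ => -1) j (sum_pole_mem _ _ (hqt j))

/-- The residues at the q_j recover p, and then c is the difference of the lower left entry and its
polar part. -/
lemma normalForm_injective (hq : Function.Injective q) (hqt : ∀ j i, q j ≠ t i)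
    {p' : Fin m → ℂ} {c' : ℂ[X]}
    (h : normalForm t θp θm q p' c' = normalForm t θp θm q p c) : p' = p ∧ c' = c := by
  have hp : p' = p := by
    funext j
    rw [← value_residue_one_zero (θp := θp) (θm := θm) (p := p') (c := c') hq hqt j, h,
      value_residue_one_zero hq hqt j]
  subst hp
  refine ⟨rfl, ?_⟩
  have h1 := congrFun (congrFun h 1) 0
  rw [normalForm_one_zero, normalForm_one_zero, add_right_inj] at h1
  exact RatFunc.algebraMap_injective ℂ h1

end NormalForm

/-! ### Reduction to the normal form -/

/-- The matrix `[[1, 0], [-g / v, 1 / v]]`. -/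
noncomputable def gauge (g v : RatFunc ℂ) : Matrix (Fin 2) (Fin 2) (RatFunc ℂ) :=
  !![1, 0; -g / v, 1 / v]

/-- The inverse `[[1, 0], [g, v]]` of `gauge g v`. -/
noncomputable def gaugeInv (g v : RatFunc ℂ) : Matrix (Fin 2) (Fin 2) (RatFunc ℂ) :=
  !![1, 0; g, v]

lemma gauge_mul_gaugeInv (g : RatFunc ℂ) {v : RatFunc ℂ} (hv : v ≠ 0) :
    gauge g v * gaugeInv g v = 1 := by
  ext i j
  fin_cases i <;> fin_cases j <;> simp [gauge, gaugeInv, Matrix.mul_apply, hv]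
  field_simp
  ring

lemma gaugeInv_mul_gauge (g : RatFunc ℂ) {v : RatFunc ℂ} (hv : v ≠ 0) :
    gaugeInv g v * gauge g v = 1 := by
  ext i j
  fin_cases i <;> fin_cases j <;> simp [gauge, gaugeInv, Matrix.mul_apply, hv]
  field_simp
  ring

/-- `gauge g v` as an invertible matrix. -/
noncomputable def gaugeUnit (g : RatFunc ℂ) {v : RatFunc ℂ} (hv : v ≠ 0) : GL (Fin 2) (RatFunc ℂ) :=
  ⟨gauge g v, gaugeInv g v, gauge_mul_gaugeInv g hv, gaugeInv_mul_gauge g hv⟩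

lemma degLE_inv_X_sub_C (a : ℂ) : DegLE (-1) (RatFunc.X - RatFunc.C a)⁻¹ := by
  rw [X_sub_C_eq]
  exact (degLE_inv_ofPoly (X_sub_C_ne_zero a)).congr (by simp)

lemma degLE_sum_pole {κ : ℕ} (z a : Fin κ → ℂ) :
    DegLE (-1) (∑ i, (RatFunc.X - RatFunc.C (z i))⁻¹ * RatFunc.C (a i)) :=
  DegLE.sum _ fun i _ => ((degLE_inv_X_sub_C (z i)).mul (degLE_C (a i))).congr (by norm_num)

/-- The Euler operator x d/dx multiplies x^(k+1) by k + 1, so the subtraction removes the top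
coefficient. -/
lemma natDegree_X_mul_derivative_sub_le {g : ℂ[X]} {k : ℕ} (hg : g.natDegree ≤ k + 1) :
    (X * derivative g - C ((k : ℂ) + 1) * g).natDegree ≤ k := by
  refine natDegree_le_iff_coeff_eq_zero.2 fun N hN => ?_
  obtain ⟨N, rfl⟩ : ∃ M, N = M + 1 := ⟨N - 1, by omega⟩
  rw [coeff_sub, coeff_X_mul, coeff_derivative, coeff_C_mul]
  rcases (Nat.lt_succ_iff.1 hN).eq_or_lt with rfl | h
  · ring
  · rw [coeff_eq_zero_of_natDegree_lt (show g.natDegree < N + 1 by omega)]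
    ring

lemma degLE_derivative_sub {g : ℂ[X]} {k : ℕ} (hg : g.natDegree ≤ k + 1) :
    DegLE ((k : ℤ) - 1) (ρ (derivative g) - RatFunc.C ((k : ℂ) + 1) * RatFunc.X⁻¹ * ρ g) := by
  have h := degLE_ofPoly_iff.2 (natDegree_X_mul_derivative_sub_le hg)
  have h1 : ρ (X * derivative g - C ((k : ℂ) + 1) * g) = RatFunc.X ^ (1 : ℤ) *
      (ρ (derivative g) - RatFunc.C ((k : ℂ) + 1) * RatFunc.X⁻¹ * ρ g) := by
    have h0 : (RatFunc.X : RatFunc ℂ) ≠ 0 := RatFunc.X_ne_zero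
    rw [map_sub, map_mul, map_mul, RatFunc.algebraMap_X, RatFunc.algebraMap_C, zpow_one]
    field_simp
  rwa [h1, degLE_X_zpow_mul_iff] at h

namespace HasNumerators

variable {n m : ℕ} {t θp θm : Fin n → ℂ} {q : Fin m → ℂ}
  {Ω : Matrix (Fin 2) (Fin 2) (RatFunc ℂ)} {N : Matrix (Fin 2) (Fin 2) ℂ[X]} {b : ℂ}

/-- The parameters `p j` of the normal form. -/
def residueParam (N : Matrix (Fin 2) (Fin 2) ℂ[X]) (q : Fin m → ℂ) (j : Fin m) : ℂ :=
  (N 0 0).eval (q j)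

/-- The polynomial `c` of the normal form. -/
noncomputable def polyParam (t : Fin n → ℂ) (q : Fin m → ℂ) (N : Matrix (Fin 2) (Fin 2) ℂ[X]) : ℂ[X] :=
  (N 0 1 * N 1 0 - N 1 1 * N 0 0) /ₘ nodal t + (derivative (nodal q) * N 0 0) /ₘ nodal q -
    derivative (N 0 0)

lemma scale_ne_zero (h : HasNumerators t θp θm q Ω N b) : RatFunc.C b * ρ (nodal q) ≠ 0 :=
  mul_ne_zero ((_root_.map_ne_zero _).2 h.ne_zero) (ofPoly_nodal_ne_zero q)

lemma ofPoly_upper (h : HasNumerators t θp θm q Ω N b) :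
    ρ (N 0 1) = RatFunc.C b * ρ (nodal q) := by
  rw [h.upper, map_mul, RatFunc.algebraMap_C]

/-- The right side is the lower left entry after the gauge. Its polar part is that of (N₀₁N₁₀ -
N₁₁N₀₀) / P + Q'N₀₀ / Q: the determinant condition gives the residues at the t_i, and Q'(q_j) = τ_j
gives N₀₀(q_j) at q_j. -/
lemma normalForm_one_zero_eq (h : HasNumerators t θp θm q Ω N b) (ht : Function.Injective t)
    (hq : Function.Injective q) :
    normalForm t θp θm q (residueParam N q) (polyParam t q N) 1 0 =
      RatFunc.C b * ρ (nodal q) * Ω 1 0 -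
        (Ω 1 1 - ρ (derivative (nodal q)) / ρ (nodal q)) * ρ (N 0 0) - ρ (derivative (N 0 0)) := by
  have h1 := div_nodal_eq_sum ht (N 0 1 * N 1 0 - N 1 1 * N 0 0)
  have h2 := div_nodal_eq_sum hq (derivative (nodal q) * N 0 0)
  have e1 (i : Fin n) : (N 0 1 * N 1 0 - N 1 1 * N 0 0).eval (t i) / tau t i =
      -(tau t i * θp i * θm i) := by
    have h0 := tau_ne_zero ht i
    rw [div_eq_iff h0]
    have := h.det i
    simp only [eval_sub, eval_mul] at this ⊢
    linear_combination -this
  have e2 (j : Fin m) : (derivative (nodal q) * N 0 0).eval (q j) / tau q j =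
      residueParam N q j := by
    rw [eval_mul, ← tau_eq_derivative, mul_div_cancel_left₀ _ (tau_ne_zero hq j), residueParam]
  simp only [e1] at h1
  simp only [e2] at h2
  rw [normalForm_one_zero, polyParam, map_sub, map_add, h.entry 1 0, h.entry 1 1]
  have hP := ofPoly_nodal_ne_zero t
  have hQ := ofPoly_nodal_ne_zero q
  have h3 : RatFunc.C b * ρ (nodal q) * (ρ (N 1 0) / ρ (nodal t)) -
        (ρ (N 1 1) / ρ (nodal t) - ρ (derivative (nodal q)) / ρ (nodal q)) * ρ (N 0 0) =
      ρ (N 0 1 * N 1 0 - N 1 1 * N 0 0) / ρ (nodal t) +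
        ρ (derivative (nodal q) * N 0 0) / ρ (nodal q) := by
    simp only [map_sub, map_mul, h.ofPoly_upper]
    field_simp
    ring
  rw [h3, h1, h2]
  ring

lemma degLE_entry₁₁ (h : HasNumerators t θp θm q Ω N b) : DegLE (-1) (Ω 1 1) := by
  have h1 : DegLE (-1) (RatFunc.X⁻¹ : RatFunc ℂ) := by simpa using degLE_X_zpow (-1)
  simpa using (h.degree₁₁.mono (by norm_num)).sub h1

/-- With g = N₀₀ of degree at most m + 1, the terms in -Ω₁₁ g, (Q' / Q) g and -g' have leading parts
(1 / x) g, (m / x) g and -((m + 1) / x) g. They cancel, and everything else has order at most m - 1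
at infinity. -/
lemma natDegree_polyParam_le (h : HasNumerators t θp θm q Ω N b) (ht : Function.Injective t)
    (hq : Function.Injective q) (hm : 1 ≤ m) : (polyParam t q N).natDegree ≤ m - 1 := by
  have h1 := h.normalForm_one_zero_eq ht hq
  rw [normalForm_one_zero] at h1
  have h2 := degLE_sum_pole t fun i => -(tau t i * θp i * θm i)
  have h3 := degLE_sum_pole q (residueParam N q)
  have hg : DegLE (m + 1 : ℕ) (ρ (N 0 0)) := degLE_ofPoly_iff.2 h.degree₀₀
  have hQ := ofPoly_nodal_ne_zero q
  have hX : (RatFunc.X : RatFunc ℂ) ≠ 0 := RatFunc.X_ne_zero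
  have hQd : DegLE m (ρ (nodal q)) := degLE_ofPoly_iff.2 (natDegree_nodal q).le
  obtain ⟨k, rfl⟩ : ∃ k, m = k + 1 := ⟨m - 1, by omega⟩
  have h4 : DegLE (-2) ((ρ (derivative (nodal q)) -
      RatFunc.C ((k : ℂ) + 1) * RatFunc.X⁻¹ * ρ (nodal q)) * (ρ (nodal q))⁻¹) := by
    refine ((degLE_derivative_sub (natDegree_nodal q).le).mul
      (degLE_inv_ofPoly (nodal_ne_zero q))).congr ?_
    rw [natDegree_nodal]
    push_cast
    ring
  have h5 := degLE_derivative_sub h.degree₀₀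
  have h6 : DegLE (k : ℤ) (RatFunc.C b * ρ (nodal q) * Ω 1 0) :=
    (((degLE_C b).mul hQd).mul h.degree₁₀).congr (by push_cast; ring)
  have h7 : DegLE (k : ℤ) ((Ω 1 1 + RatFunc.X⁻¹) * ρ (N 0 0)) :=
    (h.degree₁₁.mul hg).congr (by push_cast; ring)
  have h8 := (h4.mul hg).congr (l := k) (by push_cast; ring)
  have h9 := h5.congr (l := k) (by push_cast; ring)
  rw [Nat.add_sub_cancel, ← degLE_ofPoly_iff]
  have h10 : ρ (polyParam t q N) = RatFunc.C b * ρ (nodal q) * Ω 1 0 -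
      (Ω 1 1 + RatFunc.X⁻¹) * ρ (N 0 0) +
      ((ρ (derivative (nodal q)) - RatFunc.C ((k : ℂ) + 1) * RatFunc.X⁻¹ * ρ (nodal q)) *
        (ρ (nodal q))⁻¹) * ρ (N 0 0) -
      (ρ (derivative (N 0 0)) - RatFunc.C (((k + 1 : ℕ) : ℂ) + 1) * RatFunc.X⁻¹ * ρ (N 0 0)) -
      ∑ i, (RatFunc.X - RatFunc.C (t i))⁻¹ * RatFunc.C (-(tau t i * θp i * θm i)) -
      ∑ j, (RatFunc.X - RatFunc.C (q j))⁻¹ * RatFunc.C (residueParam N q j) := by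
    rw [eq_sub_iff_add_eq, eq_sub_iff_add_eq]
    have : ρ (polyParam t q N) +
      ∑ j, (RatFunc.X - RatFunc.C (q j))⁻¹ * RatFunc.C (residueParam N q j) +
      ∑ i, (RatFunc.X - RatFunc.C (t i))⁻¹ * RatFunc.C (-(tau t i * θp i * θm i)) =
      ∑ i, (RatFunc.X - RatFunc.C (t i))⁻¹ * RatFunc.C (-(tau t i * θp i * θm i)) +
      ∑ j, (RatFunc.X - RatFunc.C (q j))⁻¹ * RatFunc.C (residueParam N q j) +
      ρ (polyParam t q N) := by ring
    rw [this, h1]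
    simp only [map_add, map_one, Nat.cast_add, Nat.cast_one]
    field_simp
    ring
  rw [h10]
  exact ((((h6.sub h7).add h8).sub h9).sub (h2.mono (by omega))).sub (h3.mono (by omega))

lemma normalForm_one_one_eq (h : HasNumerators t θp θm q Ω N b) (ht : Function.Injective t)
    (hq : Function.Injective q) (hnm : n = m + 3) {p : Fin m → ℂ} {c : ℂ[X]} :
    normalForm t θp θm q p c 1 1 =
      Ω 0 0 + Ω 1 1 - ρ (derivative (nodal q)) / ρ (nodal q) := by
  have h1 := div_nodal_eq_sum ht (N 0 0 + N 1 1)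
  have h2 := div_nodal_eq_sum hq (derivative (nodal q))
  have e1 (i : Fin n) : (N 0 0 + N 1 1).eval (t i) / tau t i = θp i + θm i := by
    rw [h.trace, mul_div_cancel_left₀ _ (tau_ne_zero ht i)]
  have e2 (j : Fin m) : (derivative (nodal q)).eval (q j) / tau q j = 1 := by
    rw [← tau_eq_derivative, div_self (tau_ne_zero hq j)]
  have hP := ofPoly_nodal_ne_zero t
  have hdN : (N 1 1).natDegree ≤ n - 1 := by
    have h3 := h.degLE_entry₁₁
    rw [← degLE_ofPoly_iff]
    have h4 : ρ (N 1 1) = ρ (nodal t) * Ω 1 1 := by rw [h.entry, mul_div_cancel₀ _ hP]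
    rw [h4, degLE_ofPoly_mul_iff (nodal_ne_zero t), natDegree_nodal]
    exact h3.congr (by omega)
  -- The numerator of the trace has degree below n, so its partial fraction expansion has no
  -- polynomial part. Here n = m + 3 enters.
  have hd : (N 0 0 + N 1 1).degree < (nodal t).degree := by
    rw [degree_eq_natDegree (nodal_ne_zero t), natDegree_nodal]
    refine degree_lt_iff_coeff_zero _ _ |>.2 fun k hk => coeff_eq_zero_of_natDegree_lt ?_
    have := h.degree₀₀
    exact (natDegree_add_le _ _).trans_lt (max_lt (by omega) (by omega))
  rw [(divByMonic_eq_zero_iff Lagrange.nodal_monic).2 hd, map_zero, add_zero] at h1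
  rw [(divByMonic_eq_zero_iff Lagrange.nodal_monic).2
    (degree_derivative_lt (nodal_ne_zero q)), map_zero, add_zero] at h2
  simp only [e1] at h1
  simp only [e2] at h2
  rw [normalForm_one_one', ← h1, h2, h.entry 0 0, h.entry 1 1]
  simp only [map_neg, map_one, mul_neg, Finset.sum_neg_distrib, map_add, add_div]
  ring

/-- The gauge is chosen for the upper row: e₂ / v with v = bQ turns Ω₀₁ = v / P into 1 / P, and
subtracting (g / v) e₂ from e₁ cancels Ω₀₀ = g / P. The lower row is then the content of
`normalForm_one_zero_eq` and `normalForm_one_one_eq`. -/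
theorem gauge_eq (h : HasNumerators t θp θm q Ω N b) (ht : Function.Injective t)
    (hq : Function.Injective q) (hnm : n = m + 3) :
    gauge (ρ (N 0 0)) (RatFunc.C b * ρ (nodal q)) *
        normalForm t θp θm q (residueParam N q) (polyParam t q N) =
      Ω * gauge (ρ (N 0 0)) (RatFunc.C b * ρ (nodal q)) +
        (gauge (ρ (N 0 0)) (RatFunc.C b * ρ (nodal q))).map ratDeriv := by
  have hP := ofPoly_nodal_ne_zero t
  have hQ := ofPoly_nodal_ne_zero q
  have hb : RatFunc.C b ≠ 0 := (_root_.map_ne_zero _).2 h.ne_zero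
  have hv := h.scale_ne_zero
  have e00 := normalForm_zero_zero (t := t) (θp := θp) (θm := θm) (q := q) (p := residueParam N q)
    (c := polyParam t q N)
  have e01 := normalForm_zero_one (θp := θp) (θm := θm) (q := q) (p := residueParam N q)
    (c := polyParam t q N) ht (by omega)
  have e10 := h.normalForm_one_zero_eq ht hq
  have e11 := h.normalForm_one_one_eq ht hq hnm (p := residueParam N q) (c := polyParam t q N)
  have o00 := h.entry 0 0
  have o01 : Ω 0 1 = RatFunc.C b * ρ (nodal q) / ρ (nodal t) := by
    rw [h.entry, h.ofPoly_upper]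
  have d1 : ratDeriv (RatFunc.C b * ρ (nodal q)) = RatFunc.C b * ρ (derivative (nodal q)) := by
    rw [ratDeriv_mul, ratDeriv_C, ratDeriv_ofPoly, zero_mul, zero_add]
  have d2 : ratDeriv (RatFunc.C b * ρ (nodal q))⁻¹ =
      -(RatFunc.C b * ρ (derivative (nodal q))) / (RatFunc.C b * ρ (nodal q)) ^ 2 := by
    rw [ratDeriv_inv hv, d1]
  have d3 : ratDeriv (-ρ (N 0 0) / (RatFunc.C b * ρ (nodal q))) =
      -ρ (derivative (N 0 0)) / (RatFunc.C b * ρ (nodal q)) + -ρ (N 0 0) *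
        (-(RatFunc.C b * ρ (derivative (nodal q))) / (RatFunc.C b * ρ (nodal q)) ^ 2) := by
    rw [div_eq_mul_inv, ratDeriv_mul, d2, ← map_neg, ratDeriv_ofPoly, derivative_neg, map_neg,
      div_eq_mul_inv, div_eq_mul_inv (-ρ (derivative (N 0 0)))]
  ext i j
  fin_cases i <;> fin_cases j
  · simp [gauge, Matrix.mul_apply, e00, o00, o01]
    field_simp
    ring
  · simp [gauge, Matrix.mul_apply, e01, o01]
    field_simp
  · simp [gauge, Matrix.mul_apply, e00, e10]
    rw [d3]
    field_simp
    ring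
  · simp [gauge, Matrix.mul_apply, e01, e11, o00]
    rw [← mul_inv, mul_comm (ρ (nodal q)) (RatFunc.C b), d2]
    field_simp
    ring

end HasNumerators

/-! ### The isomorphism with the normal form -/

lemma gauge_mulVec (g v : RatFunc ℂ) (s : Fin 2 → RatFunc ℂ) :
    (gauge g v).mulVec s = ![s 0, (s 1 - g * s 0) / v] := by
  ext i
  fin_cases i
  · simp [gauge, Matrix.mulVec, dotProduct]
  · simp [gauge, Matrix.mulVec, dotProduct]
    ring

lemma gaugeInv_mulVec (g v : RatFunc ℂ) (s : Fin 2 → RatFunc ℂ) :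
    (gaugeInv g v).mulVec s = ![s 0, g * s 0 + v * s 1] := by
  ext i
  fin_cases i <;> simp [gaugeInv, Matrix.mulVec, dotProduct]

/-- The off-diagonal entry is a global section of Hom(𝒪, 𝒪(k)) = 𝒪(k) and the diagonal is constant
and invertible, so these matrices are bundle automorphisms. -/
lemma shear_mem_splitBundle_iff {k : ℕ} {u : ℂ} (hu : u ≠ 0) {w : ℂ[X]} (hw : w.natDegree ≤ k)
    (p : OnePoint ℂ) (s : Fin 2 → RatFunc ℂ) :
    ![s 0, RatFunc.C u * s 1 + ρ w * s 0] ∈ splitBundle 0 k p ↔ s ∈ splitBundle 0 k p := by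
  have hC : RatFunc.C u⁻¹ * RatFunc.C u = (1 : RatFunc ℂ) := by
    rw [← map_mul, inv_mul_cancel₀ hu, map_one]
  have hs1 : s 1 = RatFunc.C u⁻¹ * (RatFunc.C u * s 1 + ρ w * s 0 - ρ w * s 0) := by
    rw [add_sub_cancel_right, ← mul_assoc, hC, one_mul]
  cases p using OnePoint.rec with
  | infty =>
    simp only [mem_splitBundle_infty, Matrix.cons_val_zero, Matrix.cons_val_one]
    have hw' : DegLE k (ρ w) := degLE_ofPoly_iff.2 hw
    refine and_congr_right fun h0 => ⟨fun h1 => ?_, fun h1 => ?_⟩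
    · rw [hs1]
      exact ((degLE_C _).mul (h1.sub ((hw'.mul h0).congr (add_zero _)))).congr (zero_add _)
    · exact (((degLE_C _).mul h1).congr (zero_add _)).add ((hw'.mul h0).congr (add_zero _))
  | coe a =>
    simp only [mem_splitBundle_coe, Matrix.cons_val_zero, Matrix.cons_val_one]
    refine and_congr_right fun h0 => ⟨fun h1 => ?_, fun h1 => ?_⟩
    · rw [hs1]
      exact mul_mem (C_mem_localRing _ _) (sub_mem h1 (mul_mem (ofPoly_mem_localRing _ _) h0))
    · exact add_mem (mul_mem (C_mem_localRing _ _) h1) (mul_mem (ofPoly_mem_localRing _ _) h0)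

namespace HasNumerators

variable {n m : ℕ} {t θp θm : Fin n → ℂ} {q : Fin m → ℂ}
  {Ω : Matrix (Fin 2) (Fin 2) (RatFunc ℂ)} {N : Matrix (Fin 2) (Fin 2) ℂ[X]} {b : ℂ}

/-- In the basis e₁, e₂ / Q of E' the gauge becomes a shear with polynomial entry -N₀₀ / b, whose
degree is at most m + 1 by the bound at infinity. -/
theorem isConnIso (h : HasNumerators t θp θm q Ω N b) (ht : Function.Injective t)
    (hq : Function.Injective q) (hnm : n = m + 3) :
    IsConnIso (gaugeUnit (ρ (N 0 0)) h.scale_ne_zero) (splitBundle 0 ((m : ℤ) + 1))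
      (normalForm t θp θm q (residueParam N q) (polyParam t q N)) (transform q) Ω := by
  refine ⟨fun p s => ?_, gauge_iff.2 (h.gauge_eq ht hq hnm)⟩
  have hb : RatFunc.C b ≠ 0 := (_root_.map_ne_zero _).2 h.ne_zero
  have hQ := ofPoly_nodal_ne_zero q
  have hw : (C (-b⁻¹) * N 0 0).natDegree ≤ m + 1 := (natDegree_C_mul_le _ _).trans h.degree₀₀
  have e := shear_mem_splitBundle_iff (inv_ne_zero h.ne_zero) hw p s
  rw [Nat.cast_add_one] at e
  rw [← e, mem_transform_iff hq]
  have e1 : (gaugeUnit (ρ (N 0 0)) h.scale_ne_zero).1.mulVec s =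
      ![s 0, (s 1 - ρ (N 0 0) * s 0) / (RatFunc.C b * ρ (nodal q))] := gauge_mulVec _ _ _
  rw [e1]
  simp only [Matrix.cons_val_zero, Matrix.cons_val_one]
  have e2 : ρ (nodal q) * ((s 1 - ρ (N 0 0) * s 0) / (RatFunc.C b * ρ (nodal q))) =
      RatFunc.C b⁻¹ * s 1 + ρ (C (-b⁻¹) * N 0 0) * s 0 := by
    rw [map_mul, RatFunc.algebraMap_C, map_neg, map_inv₀]
    field_simp
    ring
  rw [e2]

/-- Both sides express s₁(q_j) = N₀₀(q_j) s₀(q_j): on the left as regularity of (s₁ - N₀₀ s₀) / bQ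
at the simple zero q_j of Q, on the right as the kernel of a matrix with lower row (p_j, -1). -/
theorem mem_transformLine_iff_residue (h : HasNumerators t θp θm q Ω N b)
    (hq : Function.Injective q) (hqt : ∀ j i, q j ≠ t i) (j : Fin m) {d₁ d₂ : ℤ} {c : ℂ[X]}
    {s : Fin 2 → RatFunc ℂ} (hs : s ∈ splitBundle d₁ d₂ (q j)) :
    (gaugeUnit (ρ (N 0 0)) h.scale_ne_zero).1.mulVec s ∈ transformLine q (q j) ↔
      (resMatrix (normalForm t θp θm q (residueParam N q) c) (q j)).mulVec
        (fun i => value (q j) (s i)) = 0 := by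
  obtain ⟨h0, h1⟩ := mem_splitBundle_coe.1 hs
  have e1 : (gaugeUnit (ρ (N 0 0)) h.scale_ne_zero).1.mulVec s =
      ![s 0, (s 1 - ρ (N 0 0) * s 0) / (RatFunc.C b * ρ (nodal q))] := gauge_mulVec _ _ _
  have hb : RatFunc.C b ≠ 0 := (_root_.map_ne_zero _).2 h.ne_zero
  have h2 : s 1 - ρ (N 0 0) * s 0 ∈ localRing (q j : OnePoint ℂ) :=
    sub_mem h1 (mul_mem (ofPoly_mem_localRing _ _) h0)
  rw [e1, mem_transformLine_iff, resMatrix_normalForm hq hqt]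
  simp only [Matrix.cons_val_zero, Matrix.cons_val_one]
  have e2 : (s 1 - ρ (N 0 0) * s 0) / (RatFunc.C b * ρ (nodal q)) =
      RatFunc.C b⁻¹ * ((s 1 - ρ (N 0 0) * s 0) / ρ (nodal q)) := by
    rw [map_inv₀]
    field_simp
  rw [e2, mul_mem_localRing_iff (C_mem_localRing _ _) (by rw [← map_inv₀]; exact C_mem_localRing _ _)
      ((_root_.map_ne_zero _).2 (inv_ne_zero h.ne_zero)),
    div_nodal_mem_iff hq j h2, value_sub h1 (mul_mem (ofPoly_mem_localRing _ _) h0),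
    value_mul (ofPoly_mem_localRing _ _) h0, value_ofPoly]
  constructor
  · rintro ⟨-, h3⟩
    ext i
    fin_cases i
    · simp [Matrix.mulVec, dotProduct]
    · simp [Matrix.mulVec, dotProduct, residueParam]
      linear_combination -h3
  · intro h3
    have h4 := congrFun h3 1
    simp [Matrix.mulVec, dotProduct, residueParam] at h4
    exact ⟨h0, by linear_combination -h4⟩

end HasNumerators

/-! ### Uniqueness of the normal form -/

lemma eq_C_of_degLE_zero {f : RatFunc ℂ} (hf : ∀ a : ℂ, f ∈ localRing (a : OnePoint ℂ))
    (h : DegLE 0 f) : ∃ u : ℂ, f = RatFunc.C u := by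
  obtain ⟨w, rfl⟩ := exists_ofPoly_of_forall_mem hf
  obtain ⟨u, rfl⟩ := natDegree_eq_zero.1 (Nat.le_zero.1 (degLE_ofPoly_iff (k := 0).1 h))
  exact ⟨u, RatFunc.algebraMap_C u⟩

/-- Isomorphic normal forms are equal. -/
theorem normalForm_eq_of_isConnIso {n m : ℕ} {t θp θm : Fin n → ℂ} {q p p' : Fin m → ℂ}
    {c c' : ℂ[X]} (ht : Function.Injective t) (hn : 0 < n) {d : ℤ} (hd : 0 < d)
    {T : GL (Fin 2) (RatFunc ℂ)}
    (h : IsConnIso T (splitBundle 0 d) (normalForm t θp θm q p' c') (splitBundle 0 d)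
      (normalForm t θp θm q p c)) :
    normalForm t θp θm q p' c' = normalForm t θp θm q p c := by
  have hmem (a : ℂ) (i j : Fin 2) : T.1 i j ∈ localRing (a : OnePoint ℂ) := by
    have h1 := mem_splitBundle_coe.1 ((h.bundle a _).2
      (single_mem_splitBundle_coe (d₁ := 0) (d₂ := d) a j))
    rw [Matrix.mulVec_single_one] at h1
    fin_cases i
    exacts [h1.1, h1.2]
  have hinf0 := mem_splitBundle_infty.1 ((h.bundle OnePoint.infty (Pi.single 0 1)).2
    (mem_splitBundle_infty.2 (by simpa using ⟨by simpa using degLE_C 1, degLE_zero d⟩)))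
  have hinf1 := mem_splitBundle_infty.1 ((h.bundle OnePoint.infty (Pi.single 1 (RatFunc.X ^ d))).2
    (mem_splitBundle_infty.2 (by simpa using ⟨degLE_zero 0, degLE_X_zpow d⟩)))
  rw [Matrix.mulVec_single_one] at hinf0
  have e (i : Fin 2) : T.1.mulVec (Pi.single 1 (RatFunc.X ^ d)) i = RatFunc.X ^ d * T.1 i 1 := by
    simp [Matrix.mulVec, dotProduct, mul_comm]
  rw [e, e, degLE_X_zpow_mul_iff, degLE_X_zpow_mul_iff, sub_self] at hinf1
  obtain ⟨u, hu⟩ := eq_C_of_degLE_zero (fun a => hmem a 0 0) hinf0.1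
  obtain ⟨v, hv⟩ := eq_C_of_degLE_zero (fun a => hmem a 1 1) hinf1.2
  -- A morphism 𝒪(d) → 𝒪 with d > 0 is zero.
  have h01 : T.1 0 1 = 0 := by
    obtain ⟨w, hw⟩ := exists_ofPoly_of_forall_mem fun a => hmem a 0 1
    have h1 := hinf1.1
    rw [hw] at h1
    rw [hw, eq_zero_of_degLE (by omega) h1, map_zero]
  have hP := ofPoly_nodal_ne_zero t
  have hg := gauge_iff.1 h.conj
  have g01 := congrFun (congrFun hg 0) 1
  have g00 := congrFun (congrFun hg 0) 0
  simp only [Matrix.mul_apply, Fin.sum_univ_two, Matrix.add_apply, Matrix.map_apply, h01, hu, hv,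
    normalForm_zero_zero, normalForm_zero_one ht hn, ratDeriv_zero, ratDeriv_C] at g01 g00
  -- The entry 1 / P fixes the ratio of the two diagonal constants; in the same way the zero upper
  -- left entry kills T₁₀ below.
  have huv : RatFunc.C u = (RatFunc.C v : RatFunc ℂ) := by
    field_simp at g01
    simpa using g01
  have h10 : T.1 1 0 = 0 := by
    field_simp at g00
    simpa using g00.symm
  have hT : T.1 = RatFunc.C u • (1 : Matrix (Fin 2) (Fin 2) (RatFunc ℂ)) := by
    ext i j
    fin_cases i <;> fin_cases j <;> simp [hu, hv, h01, h10, huv]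
  have hu0 : (RatFunc.C u : RatFunc ℂ) ≠ 0 := by
    intro h0
    have h2 : T.1 * T⁻¹.1 = 1 := by rw [← Units.val_mul, mul_inv_cancel, Units.val_one]
    rw [hT, h0, zero_smul, zero_mul] at h2
    exact zero_ne_one h2
  have hder : T.1.map ratDeriv = 0 := by
    ext i j
    fin_cases i <;> fin_cases j <;> simp [hu, hv, h01, h10]
  rw [hder, add_zero, hT, smul_mul_assoc, one_mul, mul_smul_comm, mul_one] at hg
  exact smul_right_injective _ hu0 hg

/-! ### Monodromy of the normal form -/

lemma map_value_mul {z : ℂ} {A B : Matrix (Fin 2) (Fin 2) (RatFunc ℂ)}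
    (hA : ∀ i j, A i j ∈ localRing (z : OnePoint ℂ))
    (hB : ∀ i j, B i j ∈ localRing (z : OnePoint ℂ)) :
    (A * B).map (value z) = A.map (value z) * B.map (value z) := by
  ext i j
  simp only [Matrix.map_apply, Matrix.mul_apply]
  rw [value_sum _ _ fun k _ => mul_mem (hA i k) (hB k j)]
  exact Finset.sum_congr rfl fun k _ => value_mul (hA i k) (hB k j)

lemma map_value_add {z : ℂ} {A B : Matrix (Fin 2) (Fin 2) (RatFunc ℂ)}
    (hA : ∀ i j, A i j ∈ localRing (z : OnePoint ℂ))
    (hB : ∀ i j, B i j ∈ localRing (z : OnePoint ℂ)) :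
    (A + B).map (value z) = A.map (value z) + B.map (value z) := by
  ext i j
  exact value_add (hA i j) (hB i j)

lemma mul_mem_localRing_entries {z : ℂ} {A B : Matrix (Fin 2) (Fin 2) (RatFunc ℂ)}
    (hA : ∀ i j, A i j ∈ localRing (z : OnePoint ℂ))
    (hB : ∀ i j, B i j ∈ localRing (z : OnePoint ℂ)) (i j : Fin 2) :
    (A * B) i j ∈ localRing (z : OnePoint ℂ) := by
  rw [Matrix.mul_apply]
  exact sum_mem fun k _ => mul_mem (hA i k) (hB k j)

/-- Transport of a fundamental matrix by a rational gauge transformation. -/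
lemma hasDerivAt_gauge_mul {z μ : ℂ} {G Ω Ω' : Matrix (Fin 2) (Fin 2) (RatFunc ℂ)}
    (hG : ∀ i j, G i j ∈ localRing (z : OnePoint ℂ))
    (hΩ : ∀ i j, Ω i j ∈ localRing (z : OnePoint ℂ))
    (hΩ' : ∀ i j, Ω' i j ∈ localRing (z : OnePoint ℂ))
    (h : G * Ω = Ω' * G + G.map ratDeriv) {Y : ℂ → Matrix (Fin 2) (Fin 2) ℂ}
    (hY : ∀ i j, HasDerivAt (fun w => Y w i j) ((-((Ω.map (value z) + μ • 1) * Y z)) i j) z)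
    (i j : Fin 2) : HasDerivAt (fun w => (G.map (value w) * Y w) i j)
      ((-((Ω'.map (value z) + μ • 1) * (G.map (value z) * Y z))) i j) z := by
  have hG' : ∀ i j, HasDerivAt (fun w => G.map (value w) i j)
      ((G.map ratDeriv).map (value z) i j) z := fun i j => hasDerivAt_value (hG i j)
  refine (hasDerivAt_matrix_mul hG' (B' := -((Ω.map (value z) + μ • 1) * Y z)) hY i j).congr_deriv ?_
  have h1 := congrArg (fun A => A.map (value z)) h
  rw [map_value_mul hG hΩ, map_value_add (B := G.map ratDeriv) (mul_mem_localRing_entries hΩ' hG)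
    (fun i j => ratDeriv_mem_localRing (hG i j)), map_value_mul hΩ' hG] at h1
  rw [← sub_eq_iff_eq_add'] at h1
  rw [← h1]
  refine congrFun (congrFun ?_ i) j
  simp only [add_mul, sub_mul, mul_neg, mul_add, smul_mul_assoc, mul_smul_comm, one_mul,
    Matrix.mul_assoc]
  abel

section Monodromy

variable {n m : ℕ} {t θp θm : Fin n → ℂ} {q : Fin m → ℂ}

lemma eventually_ne_points (hq : Function.Injective q) (hqt : ∀ j i, q j ≠ t i) (j : Fin m) :
    ∀ᶠ z in nhdsWithin (q j) {q j}ᶜ, (∀ i, z ≠ t i) ∧ ∀ k, z ≠ q k := by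
  refine (Filter.eventually_all.2 fun i => ?_).and (Filter.eventually_all.2 fun k => ?_)
  · exact nhdsWithin_le_nhds (eventually_ne_nhds (hqt j i))
  · by_cases hk : k = j
    · subst hk
      exact self_mem_nhdsWithin
    · exact nhdsWithin_le_nhds (eventually_ne_nhds (hq.ne (Ne.symm hk)))

lemma normalForm_mem_localRing {p : Fin m → ℂ} {c : ℂ[X]} {z : ℂ} (ht : ∀ i, z ≠ t i)
    (hq : ∀ k, z ≠ q k) (i j : Fin 2) :
    normalForm t θp θm q p c i j ∈ localRing (z : OnePoint ℂ) := by
  fin_cases i <;> fin_cases j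
  · simp [normalForm_zero_zero, zero_mem]
  · simp only [Fin.zero_eta, Fin.mk_one, normalForm_zero_one']
    exact sum_pole_mem _ (fun i => 1 / tau t i) ht
  · simp only [Fin.zero_eta, Fin.mk_one, normalForm_one_zero]
    exact add_mem (add_mem (sum_pole_mem _ (fun i => -(tau t i * θp i * θm i)) ht)
      (sum_pole_mem _ _ hq)) (ofPoly_mem_localRing _ _)
  · simp only [Fin.mk_one, normalForm_one_one']
    exact add_mem (sum_pole_mem _ (fun i => θp i + θm i) ht) (sum_pole_mem _ (fun _ => -1) hq)

namespace HasNumerators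

variable {Ω : Matrix (Fin 2) (Fin 2) (RatFunc ℂ)} {N : Matrix (Fin 2) (Fin 2) ℂ[X]} {b : ℂ}

lemma entry_mem_localRing (h : HasNumerators t θp θm q Ω N b) {z : ℂ} (hz : ∀ i, z ≠ t i)
    (i j : Fin 2) : Ω i j ∈ localRing (z : OnePoint ℂ) := by
  rw [h.entry]
  exact div_mem_localRing _ (eval_nodal_ne_zero t hz)

/-- A fundamental matrix of Ω exists around its regular point q_j; its image under the inverse gauge
is single-valued, so μ = 0 works. The determinant of that gauge vanishes only at the q_k, outside a
small punctured disc. -/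
theorem hasScalarMonodromy (h : HasNumerators t θp θm q Ω N b) (ht : Function.Injective t)
    (hq : Function.Injective q) (hqt : ∀ j i, q j ≠ t i) (hnm : n = m + 3) (j : Fin m) :
    HasScalarMonodromy (normalForm t θp θm q (residueParam N q) (polyParam t q N)) (q j) := by
  obtain ⟨Y, hY⟩ := exists_fundamental_matrix (q := q j) (A := fun z => Ω.map (value z))
    fun i k => analyticAt_value (h.entry_mem_localRing (hqt j) i k)
  set L := gaugeInv (ρ (N 0 0)) (RatFunc.C b * ρ (nodal q)) with hL
  have hconj : L * Ω = normalForm t θp θm q (residueParam N q) (polyParam t q N) * L +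
    L.map ratDeriv := gauge_iff.1 (h.isConnIso ht hq hnm).symm.conj
  have hLmem (z : ℂ) (i k : Fin 2) : L i k ∈ localRing (z : OnePoint ℂ) := by
    fin_cases i <;> fin_cases k
    · simp [hL, gaugeInv, one_mem]
    · simp [hL, gaugeInv, zero_mem]
    · exact ofPoly_mem_localRing z (N 0 0)
    · exact mul_mem (C_mem_localRing z b) (ofPoly_mem_localRing z (nodal q))
  have hLdet (z : ℂ) : (L.map (value z)).det = b * (nodal q).eval z := by
    rw [Matrix.det_fin_two]
    simp [hL, gaugeInv, value_mul (C_mem_localRing z b) (ofPoly_mem_localRing z (nodal q))]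
  have hev := hY.and (eventually_ne_points hq hqt j)
  obtain ⟨r, hr, hball⟩ := Metric.mem_nhdsWithin_iff.1 hev
  refine ⟨0, r, fun z => L.map (value z) * Y z, hr, fun x hx hxr => ?_⟩
  obtain ⟨⟨hd, hY'⟩, hxt, hxq⟩ := hball ⟨by rwa [Metric.mem_ball, dist_eq_norm], hx⟩
  refine ⟨?_, ?_⟩
  · rw [Matrix.det_mul, hLdet]
    exact mul_ne_zero (mul_ne_zero h.ne_zero (eval_nodal_ne_zero q hxq)) hd
  · refine hasDerivAt_gauge_mul (hLmem x) (fun i k => h.entry_mem_localRing hxt i k)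
      (fun i k => normalForm_mem_localRing hxt hxq i k) hconj ?_
    simpa using hY'

/-- The perturbation δ of the polynomial becomes, after the gauge, δ / bQ in the lower left entry of
a matrix regular at q_j. Its residue there is nilpotent and nonzero exactly when δ(q_j) ≠ 0; the
rational gauge leaves the scalar monodromy intact. -/
theorem eval_eq_zero_of_hasScalarMonodromy (h : HasNumerators t θp θm q Ω N b)
    (ht : Function.Injective t) (hq : Function.Injective q) (hqt : ∀ j i, q j ≠ t i)
    (hnm : n = m + 3) {j : Fin m} {c : ℂ[X]}
    (hc : HasScalarMonodromy (normalForm t θp θm q (residueParam N q) c) (q j)) :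
    (c - polyParam t q N).eval (q j) = 0 := by
  obtain ⟨μ, r, Y, hr, hY⟩ := hc
  set δ := c - polyParam t q N with hδ
  set v := RatFunc.C b * ρ (nodal q) with hv
  set G := gauge (ρ (N 0 0)) v with hG
  have hv0 : v ≠ 0 := h.scale_ne_zero
  have hx0 := X_sub_C_ne_zero' (q j)
  -- splitting of the perturbation `δ / v` into polar part and regular part
  set Qj := Lagrange.nodal (Finset.univ.erase j) q with hQj
  have hQj0 : (C b * Qj).eval (q j) ≠ 0 := by
    rw [eval_mul, eval_C]
    exact mul_ne_zero h.ne_zero (eval_nodal_erase_ne_zero hq j)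
  have hbQj : ρ (C b * Qj) ≠ 0 := ofPoly_ne_zero fun h0 => hQj0 (by rw [h0, eval_zero])
  set f := ρ δ / ρ (C b * Qj) with hf
  have hfmem : f ∈ localRing (q j : OnePoint ℂ) := div_mem_localRing _ hQj0
  set ν := value (q j) f with hνdef
  set k := (f - RatFunc.C ν) / (RatFunc.X - RatFunc.C (q j)) with hk
  have hkmem : k ∈ localRing (q j : OnePoint ℂ) := by
    rw [hk, div_X_sub_C_mem_iff (sub_mem hfmem (C_mem_localRing _ _)),
      value_sub hfmem (C_mem_localRing _ _), value_C, sub_self]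
  have hsplit : ρ δ / v = k + (RatFunc.X - RatFunc.C (q j))⁻¹ * RatFunc.C ν := by
    have e1 : v = (RatFunc.X - RatFunc.C (q j)) * ρ (C b * Qj) := by
      rw [hv, nodal_eq_mul q j, map_mul, map_mul, ← X_sub_C_eq, RatFunc.algebraMap_C]
      ring
    rw [hk, e1, hf]
    field_simp
    ring
  set A : Matrix (Fin 2) (Fin 2) (RatFunc ℂ) := Ω + !![0, 0; k, 0] with hA
  set B : Matrix (Fin 2) (Fin 2) (RatFunc ℂ) :=
    A + !![0, 0; (RatFunc.X - RatFunc.C (q j))⁻¹ * RatFunc.C ν, 0] with hB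
  have hB' : B = Ω + !![0, 0; ρ δ / v, 0] := by
    rw [hB, hA, add_assoc, hsplit]
    congr 1
    ext i l
    fin_cases i <;> fin_cases l <;> simp
  have hconj : G * normalForm t θp θm q (residueParam N q) c = B * G + G.map ratDeriv := by
    rw [normalForm_add_single (c := polyParam t q N) c, mul_add, h.gauge_eq ht hq hnm, hB', add_mul,
      add_right_comm]
    congr 2
    ext i l
    fin_cases i <;> fin_cases l <;> simp [hG, gauge, Matrix.mul_apply, hδ]
    ring
  have hAmem {z : ℂ} (hz : ∀ i, z ≠ t i) (hkz : k ∈ localRing (z : OnePoint ℂ)) (i l : Fin 2) :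
      A i l ∈ localRing (z : OnePoint ℂ) := by
    refine add_mem (h.entry_mem_localRing hz i l) ?_
    fin_cases i <;> fin_cases l <;> simp [zero_mem, hkz]
  have hGmem {z : ℂ} (hz : ∀ k, z ≠ q k) (i l : Fin 2) : G i l ∈ localRing (z : OnePoint ℂ) := by
    have hinv : v⁻¹ ∈ localRing (z : OnePoint ℂ) := by
      have e1 : v = ρ (C b * nodal q) := by rw [hv, map_mul, RatFunc.algebraMap_C]
      rw [e1]
      refine ofPoly_inv_mem_localRing ?_
      rw [eval_mul, eval_C]
      exact mul_ne_zero h.ne_zero (eval_nodal_ne_zero q hz)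
    fin_cases i <;> fin_cases l
    · simp [hG, gauge, one_mem]
    · simp [hG, gauge, zero_mem]
    · simpa [hG, gauge, div_eq_mul_inv] using mul_mem (ofPoly_mem_localRing z (N 0 0)) hinv
    · simpa [hG, gauge] using hinv
  have hGdet {z : ℂ} (hz : ∀ k, z ≠ q k) : (G.map (value z)).det ≠ 0 := by
    have e1 : v = ρ (C b * nodal q) := by rw [hv, map_mul, RatFunc.algebraMap_C]
    have e2 : (C b * nodal q).eval z ≠ 0 := by
      rw [eval_mul, eval_C]
      exact mul_ne_zero h.ne_zero (eval_nodal_ne_zero q hz)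
    rw [Matrix.det_fin_two]
    simpa [hG, gauge, e1, value_inv (ofPoly_mem_localRing z (C b * nodal q))
      (by rwa [value_ofPoly]), -map_mul, and_comm] using e2
  have hν : ν = 0 := by
    refine nilpotent_residue_eq_zero (q := q j) (μ := μ) (A := fun z => A.map (value z))
      (Z := fun z => G.map (value z) * Y z)
      (fun i l => analyticAt_value (hAmem (hqt j) hkmem i l)) ?_
    have hrev : ∀ᶠ z in nhdsWithin (q j) {q j}ᶜ, ‖z - q j‖ < r := by
      refine nhdsWithin_le_nhds ?_
      filter_upwards [Metric.ball_mem_nhds (q j) hr] with z hz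
      rwa [← dist_eq_norm]
    filter_upwards [eventually_ne_points hq hqt j, self_mem_nhdsWithin, hrev,
      nhdsWithin_le_nhds (eventually_mem_localRing hkmem)] with z hz hzq hzr hkz
    obtain ⟨hd, hY'⟩ := hY z hzq hzr
    refine ⟨by rw [Matrix.det_mul]; exact mul_ne_zero (hGdet hz.2) hd, ?_⟩
    have hpol : (RatFunc.X - RatFunc.C (q j))⁻¹ ∈ localRing (z : OnePoint ℂ) :=
      inv_X_sub_C_mem (hz.2 j)
    have hpol' : (RatFunc.X - RatFunc.C (q j))⁻¹ * RatFunc.C ν ∈ localRing (z : OnePoint ℂ) :=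
      mul_mem hpol (C_mem_localRing _ _)
    have hNmem (i l : Fin 2) : (!![0, 0; (RatFunc.X - RatFunc.C (q j))⁻¹ * RatFunc.C ν, 0] :
        Matrix (Fin 2) (Fin 2) (RatFunc ℂ)) i l ∈ localRing (z : OnePoint ℂ) := by
      fin_cases i <;> fin_cases l <;> simp [zero_mem, hpol']
    have hBval : B.map (value z) = A.map (value z) + (z - q j)⁻¹ • !![0, 0; ν, 0] := by
      rw [hB, map_value_add (hAmem hz.1 hkz) hNmem]
      congr 1
      ext i l
      fin_cases i <;> fin_cases l <;> simp [value_mul hpol (C_mem_localRing z ν),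
        value_inv (X_sub_C_mem z (q j)) (by rw [value_X_sub_C]; exact sub_ne_zero.2 hzq),
        value_X_sub_C]
    have hBmem (i l : Fin 2) : B i l ∈ localRing (z : OnePoint ℂ) :=
      add_mem (hAmem hz.1 hkz i l) (hNmem i l)
    intro i l
    have := hasDerivAt_gauge_mul (hGmem hz.2) (normalForm_mem_localRing hz.1 hz.2) hBmem hconj hY'
      i l
    rwa [hBval] at this
  rw [hνdef, hf, value_div _ hQj0, div_eq_zero_iff, or_iff_left hQj0] at hν
  exact hν

/-- Scalar monodromy makes the difference of the two polynomials vanish at m distinct points, one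
more than its degree allows unless it is zero. -/
theorem hasScalarMonodromy_iff (h : HasNumerators t θp θm q Ω N b) (ht : Function.Injective t)
    (hq : Function.Injective q) (hqt : ∀ j i, q j ≠ t i) (hnm : n = m + 3) (hm : 1 ≤ m) {c : ℂ[X]}
    (hc : c.natDegree ≤ m - 1) :
    (∀ j, HasScalarMonodromy (normalForm t θp θm q (residueParam N q) c) (q j)) ↔
      c = polyParam t q N := by
  constructor
  · intro hmono
    have hz j := h.eval_eq_zero_of_hasScalarMonodromy ht hq hqt hnm (hmono j)
    refine sub_eq_zero.1 (eq_zero_of_natDegree_lt_card_of_eval_eq_zero _ hq hz ?_)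
    refine (natDegree_sub_le _ _).trans_lt ?_
    rw [Fintype.card_fin]
    exact max_lt (by omega) ((h.natDegree_polyParam_le ht hq hm).trans_lt (by omega))
  · rintro rfl
    exact h.hasScalarMonodromy ht hq hqt hnm

/-- Two connections with the same parameters `q j`, `p j` are conjugate by an automorphism of
`𝒪 ⊕ 𝒪(1)`. -/
theorem isConnIso_of_residueParam_eq {Ω' : Matrix (Fin 2) (Fin 2) (RatFunc ℂ)}
    {N' : Matrix (Fin 2) (Fin 2) ℂ[X]} {b' : ℂ} (h : HasNumerators t θp θm q Ω N b)
    (h' : HasNumerators t θp θm q Ω' N' b') (ht : Function.Injective t)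
    (hq : Function.Injective q) (hnm : n = m + 3)
    (hp : residueParam N' q = residueParam N q) (hc : polyParam t q N' = polyParam t q N) :
    ∃ M : GL (Fin 2) (RatFunc ℂ), IsConnIso M (splitBundle 0 1) Ω' (splitBundle 0 1) Ω ∧
      IsConnIso M (transform q) Ω' (transform q) Ω := by
  have e1 := h.isConnIso ht hq hnm
  have e2 := h'.isConnIso ht hq hnm
  rw [hp, hc] at e2
  have e3 := e2.symm.trans e1
  refine ⟨_, ⟨fun p s => ?_, e3.conj⟩, e3⟩
  -- Equality of the p_j means that the two polynomials N₀₀ agree at every q_j; the quotient by Q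
  -- has degree at most (m + 1) - m = 1.
  have hdvd : nodal q ∣ N' 0 0 - N 0 0 := by
    rw [nodal, Lagrange.nodal_eq]
    refine Finset.prod_dvd_of_coprime (fun i _ j _ hij => ?_) fun j _ => dvd_iff_isRoot.2 ?_
    · exact isCoprime_X_sub_C_of_isUnit_sub (sub_ne_zero.2 (hq.ne hij)).isUnit
    · have := congrFun hp j
      simp only [residueParam] at this
      rw [IsRoot, eval_sub, this, sub_self]
  obtain ⟨w, hw⟩ := hdvd
  have hwd : w.natDegree ≤ 1 := by
    by_cases hw0 : w = 0
    · simp [hw0]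
    have h1 := congrArg natDegree hw
    rw [natDegree_mul (nodal_ne_zero q) hw0, natDegree_nodal] at h1
    have h2 := natDegree_sub_le (N' 0 0) (N 0 0)
    have h3 := h.degree₀₀
    have h4 := h'.degree₀₀
    have := h2.trans (max_le h4 h3)
    omega
  have hsh := shear_mem_splitBundle_iff (k := 1) (div_ne_zero h'.ne_zero h.ne_zero)
    (w := C b⁻¹ * w) ((natDegree_C_mul_le _ _).trans hwd) p s
  rw [Nat.cast_one] at hsh
  rw [← hsh]
  have e4 : (gaugeUnit (ρ (N 0 0)) h.scale_ne_zero * (gaugeUnit (ρ (N' 0 0)) h'.scale_ne_zero)⁻¹ :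
      GL (Fin 2) (RatFunc ℂ)).1.mulVec s = (gauge (ρ (N 0 0)) (RatFunc.C b * ρ (nodal q))).mulVec
        ((gaugeInv (ρ (N' 0 0)) (RatFunc.C b' * ρ (nodal q))).mulVec s) := by
    rw [Units.val_mul, ← Matrix.mulVec_mulVec]
    rfl
  have hb : RatFunc.C b ≠ 0 := (_root_.map_ne_zero _).2 h.ne_zero
  have hQ := ofPoly_nodal_ne_zero q
  have e5 : (ρ (N' 0 0) * s 0 + RatFunc.C b' * ρ (nodal q) * s 1 - ρ (N 0 0) * s 0) /
      (RatFunc.C b * ρ (nodal q)) = RatFunc.C (b' / b) * s 1 + ρ (C b⁻¹ * w) * s 0 := by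
    have h5 : ρ (N' 0 0) = ρ (N 0 0) + ρ (nodal q) * ρ w := by
      rw [← map_mul, ← hw, map_sub, add_sub_cancel]
    rw [h5, map_mul, RatFunc.algebraMap_C, map_inv₀, map_div₀]
    field_simp
    ring
  rw [e4, gaugeInv_mulVec, gauge_mulVec]
  simp only [Matrix.cons_val_zero, Matrix.cons_val_one]
  rw [e5]

end HasNumerators

end Monodromy

end Garnier

/-! ### Assembly of the four claims -/

theorem mainTheorem3 (n : ℕ) (hn : 4 ≤ n) (t θp θm : Fin n → ℂ) (q : Fin (n - 3) → ℂ)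
    (ht : Function.Injective t) (hq : Function.Injective q) (hqt : ∀ j i, q j ≠ t i)
    (Ω : Matrix (Fin 2) (Fin 2) (RatFunc ℂ)) (hΩ : Garnier.IsGarnier t θp θm q Ω) :
    ∃ (p : Fin (n - 3) → ℂ) (c : Polynomial ℂ), c.natDegree ≤ n - 4 ∧
      -- the connection on the transformed bundle is isomorphic to the normal form, and the new
      -- parabolic structure corresponds to the kernels of the residues at the apparent points
      (∃ M : GL (Fin 2) (RatFunc ℂ),
        Garnier.IsConnIso M (Garnier.splitBundle 0 ((n : ℤ) - 2))
          (Garnier.normalForm t θp θm q p c) (Garnier.transform q) Ω ∧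
        ∀ j, ∀ s ∈ Garnier.splitBundle 0 ((n : ℤ) - 2) (OnePoint.some (q j)),
          M.1.mulVec s ∈ Garnier.transformLine q (OnePoint.some (q j)) ↔
            (Garnier.resMatrix (Garnier.normalForm t θp θm q p c) (q j)).mulVec
              (fun i => Garnier.value (q j) (s i)) = 0) ∧
      -- the normal form is unique
      (∀ (p' : Fin (n - 3) → ℂ) (c' : Polynomial ℂ),
        (∃ M : GL (Fin 2) (RatFunc ℂ),
          Garnier.IsConnIso M (Garnier.splitBundle 0 ((n : ℤ) - 2))
            (Garnier.normalForm t θp θm q p' c') (Garnier.transform q) Ω) → p' = p ∧ c' = c) ∧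
      -- the polynomial is determined by the scalar monodromy at the apparent points
      (∀ c' : Polynomial ℂ, c'.natDegree ≤ n - 4 →
        ((∀ j, Garnier.HasScalarMonodromy (Garnier.normalForm t θp θm q p c') (q j)) ↔ c' = c)) ∧
      -- the connection is determined by the points `q j` and the values `p j`
      (∀ (Ω' : Matrix (Fin 2) (Fin 2) (RatFunc ℂ)) (c' : Polynomial ℂ),
        Garnier.IsGarnier t θp θm q Ω' →
        (∃ M : GL (Fin 2) (RatFunc ℂ),
          Garnier.IsConnIso M (Garnier.splitBundle 0 ((n : ℤ) - 2))
            (Garnier.normalForm t θp θm q p c') (Garnier.transform q) Ω') →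
        ∃ M : GL (Fin 2) (RatFunc ℂ),
          Garnier.IsConnIso M (Garnier.splitBundle 0 1) Ω' (Garnier.splitBundle 0 1) Ω ∧
          Garnier.IsConnIso M (Garnier.transform q) Ω' (Garnier.transform q) Ω) := by
  have hnm : n = (n - 3) + 3 := by omega
  have hm1 : 1 ≤ n - 3 := by omega
  have hd : ((n : ℤ) - 2) = ((n - 3 : ℕ) : ℤ) + 1 := by omega
  have hdeg : n - 4 = n - 3 - 1 := by omega
  obtain ⟨N, b, h⟩ := hΩ.exists_hasNumerators hn ht hq hqt
  rw [hd, hdeg]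
  have hiso := h.isConnIso ht hq hnm
  refine ⟨Garnier.HasNumerators.residueParam N q, Garnier.HasNumerators.polyParam t q N,
    h.natDegree_polyParam_le ht hq hm1, ⟨_, hiso, fun j s hs =>
      h.mem_transformLine_iff_residue hq hqt j hs⟩, ?_, fun c' hc' =>
      h.hasScalarMonodromy_iff ht hq hqt hnm hm1 hc', ?_⟩
  · rintro p' c' ⟨M, hM⟩
    exact Garnier.normalForm_injective hq hqt
      (Garnier.normalForm_eq_of_isConnIso ht (by omega) (by omega) (hM.trans hiso.symm))
  · rintro Ω' c' hΩ' ⟨M, hM⟩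
    obtain ⟨N', b', h'⟩ := hΩ'.exists_hasNumerators hn ht hq hqt
    obtain ⟨hp, hc⟩ := Garnier.normalForm_injective hq hqt
      (Garnier.normalForm_eq_of_isConnIso ht (by omega) (by omega)
        (hM.trans (h'.isConnIso ht hq hnm).symm))
    -- Both polynomials have scalar monodromy at the q_j for the same parameters p, so the monodromy
    -- criterion for Ω identifies them.
    have hc' : Garnier.HasNumerators.polyParam t q N' = Garnier.HasNumerators.polyParam t q N := by
      refine (h.hasScalarMonodromy_iff ht hq hqt hnm hm1
        (h'.natDegree_polyParam_le ht hq hm1)).1 fun j => ?_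
      rw [hp]
      exact h'.hasScalarMonodromy ht hq hqt hnm j
    exact h.isConnIso_of_residueParam_eq h' ht hq hnm hp.symm hc'
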